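/- Manifolds are Hausdorff $C^\infty$-manifolds of constant finite dimension (paracompactness is not part of the definition). A \emph{smooth tensor stack} $\mathcal F$ assigns to each manifold $X$ a $\mathbb C$-linear symmetric monoidal category $(\mathcal F(X),\otimes,\mathbf 1_X)$ with finite direct sums and an antilinear symmetric monoidal involution $E\mapsto E^*$ (a tensor* category), and to each smooth map $f:X\to Y$ a $\mathbb C$-linear tensor* functor $f^*:\mathcal F(Y)\to\mathcal F(X)$, with coherent tensor* isomorphisms $f^*g^*\cong(gf)^*$ and $\mathrm{Id}\cong\mathrm{id}_X^*$, such that morphisms and objects glue along open covers, together with isomorphisms of complex algebras $\mathrm{End}(\mathbf 1_X)\cong C^\infty(X,\mathbb C)$ under which pull-back along $f$ becomes composition with $f$. For $E\in\mathcal F(X)$ write $E|_U$ for its pull-back along an inclusion $U\hookrightarrow X$, $\Gamma E(U)=\mathrm{Hom}(\mathbf 1_U,E|_U)$ for open $U$ (a sheaf of $C^\infty_X$-modules), $V_*=\mathrm{Hom}(\mathbf 1_{\mathrm{pt}},V)$ for $V\in\mathcal F(\mathrm{pt})$, and $E_x=(x^*E)_*$ for the fibre at $x\in X$. A \emph{metric}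 on $E$ is a morphism $E\otimes E^*\to\mathbf 1_X$ that induces a positive definite Hermitian form on every $E_x$. The stack $\mathcal F$ is \emph{Euclidean} if: (1) the canonical morphisms $\Gamma E\otimes_{C^\infty_X}\Gamma E'\to\Gamma(E\otimes E')$ and $f^*(\Gamma F)\to\Gamma(f^*F)$ are epimorphisms of sheaves; (2) a morphism $a:E\to E'$ that induces zero on every fibre is zero; (3) every morphism $\alpha:\Gamma E\to\Gamma F$ of sheaves of $C^\infty_X$-modules that is compatible, through evaluation of sections at points, with some family of linear maps $E_x\to F_x$ is of the form $\Gamma a$ for some $a:E\to F$; (4) every object has a metric over some open neighbourhood of each point; (5) over the one-point manifold, the functor $V\mapsto V_*$ to complex vector spaces is fully faithful with finite dimensional values, and the canonical maps $V_*\otimes W_*\to(V\otimes W)_*$ and $\mathbb C\to(\mathbf 1_{\mathrm{pt}})_*$ are isomorphisms; (6) every $\Gamma E$ is a locally finitely generated $C^\infty_X$-module. \textbf{Lemma.} Let $\mathcal F$ be a Euclidean smooth tensor stack, $X$ a paracompact manifold and $i_S:S\hookrightarrow X$ a closed submanifold. Let $E,F$ be objects of $\mathcal F(X)$ such that $E|_S=i_S^*E$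 is locally free of locally finite rank, i.e. every point of $S$ has an open neighbourhood $A$ in $S$ such that $(E|_S)|_A$ is isomorphic to a finite direct sum $\mathbf 1_A\oplus\cdots\oplus\mathbf 1_A$. Then for every morphism $a':E|_S\to F|_S$ in $\mathcal F(S)$ there is a morphism $a:E\to F$ in $\mathcal F(X)$ with $i_S^*a=a'$. -/

import Mathlib

open CategoryTheory MonoidalCategory TopologicalSpace
open scoped Manifold ContDiff

universe u v w v₁ v₂ u₁ u₂

noncomputable section

/-! ### The category of smooth manifolds -/

/-- A smooth manifold: a Hausdorff space with a smooth atlas modelled on `ℝ^dim`.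
Neither paracompactness nor second countability is part of the definition. -/
structure Mfd : Type (u + 1) where
  carrier : Type u
  dim : ℕ
  [top : TopologicalSpace carrier]
  [t2 : T2Space carrier]
  [charted : ChartedSpace (EuclideanSpace ℝ (Fin dim)) carrier]
  [smooth : IsManifold (𝓡 dim) ∞ carrier]

namespace Mfd

instance : CoeSort Mfd.{u} (Type u) := ⟨Mfd.carrier⟩

attribute [instance] Mfd.top Mfd.t2 Mfd.charted Mfd.smooth

/-- Morphisms of manifolds are the smooth maps. -/
instance : Category Mfd.{u} where
  Hom X Y := C^∞⟮𝓡 X.dim, X; 𝓡 Y.dim, Y⟯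
  id X := ContMDiffMap.id
  comp f g := ContMDiffMap.comp g f

/-- The smooth map underlying a morphism of manifolds. -/
def toMap {X Y : Mfd.{u}} (f : X ⟶ Y) : C^∞⟮𝓡 X.dim, X; 𝓡 Y.dim, Y⟯ := f

/-- An open subset of a manifold, as a manifold. -/
def ofOpens (X : Mfd.{u}) (U : Opens X) : Mfd.{u} where
  carrier := U
  dim := X.dim

/-- The inclusion of an open subset. -/
def ι {X : Mfd.{u}} (U : Opens X) : X.ofOpens U ⟶ X :=
  (⟨Subtype.val, contMDiff_subtype_val⟩ : C^∞⟮𝓡 X.dim, U; 𝓡 X.dim, X⟯)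

/-- The inclusion of an open subset into a larger one. -/
def incl {X : Mfd.{u}} {V U : Opens X} (h : V ≤ U) : X.ofOpens V ⟶ X.ofOpens U :=
  (⟨Set.inclusion h, contMDiff_inclusion h⟩ : C^∞⟮𝓡 X.dim, V; 𝓡 X.dim, U⟯)

lemma incl_ι {X : Mfd.{u}} {V U : Opens X} (h : V ≤ U) : incl h ≫ ι U = ι V := rfl

lemma incl_incl {X : Mfd.{u}} {W V U : Opens X} (h : W ≤ V) (h' : V ≤ U) :
    incl h ≫ incl h' = incl (h.trans h') := rfl

/-- The one-point manifold. -/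
def pt : Mfd.{u} where
  carrier := PUnit.{u + 1}
  dim := 0
  charted := ChartedSpace.ofDiscreteTopology
  smooth :=
    letI : ChartedSpace (EuclideanSpace ℝ (Fin 0)) PUnit.{u + 1} :=
      ChartedSpace.ofDiscreteTopology
    IsManifold.of_discreteTopology ∞

/-- A point of a manifold, as a map from the one-point manifold. -/
def point {X : Mfd.{u}} (x : X) : pt.{u} ⟶ X :=
  (ContMDiffMap.const x : C^∞⟮𝓡 pt.{u}.dim, pt.{u}; 𝓡 X.dim, X⟯)

lemma point_ι {X : Mfd.{u}} (U : Opens X) (x : X) (hx : x ∈ U) :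
    point (X := X.ofOpens U) (⟨x, hx⟩ : U) ≫ ι U = point x := rfl

instance contMDiffRing_complex : ContMDiffRing 𝓘(ℝ, ℂ) ∞ ℂ :=
  { instNormedSpaceLieAddGroup with
    contMDiff_mul := by
      rw [contMDiff_iff]
      refine ⟨continuous_mul, fun x y => ?_⟩
      simp only [mfld_simps, chartAt_self_eq]
      rw [contDiffOn_univ]
      exact contDiff_mul }

/-- The algebra of complex-valued smooth functions on a manifold. -/
abbrev SmoothFn (X : Mfd.{u}) := C^∞⟮𝓡 X.dim, X; 𝓘(ℝ, ℂ), ℂ⟯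

/-- `i : S ⟶ X` exhibits `S` as a closed submanifold of `X`. -/
def IsClosedSubmanifold {S X : Mfd.{u}} (i : S ⟶ X) : Prop :=
  Manifold.IsSmoothEmbedding (𝓡 S.dim) (𝓡 X.dim) ∞ (toMap i) ∧ IsClosed (Set.range (toMap i))

end Mfd

/-! ### Complex tensor* categories -/

section TensorStar

/-- An anti-involution on a complex tensor category: an antilinear symmetric tensor functor
`E ↦ E^*` with a tensor isomorphism `E^{**} ≅ E` satisfying the triangle identity.
(On vector spaces `E^*` is the complex conjugate space.) -/
class AntiInvolution (C : Type u₁) [Category.{v₁} C] [Preadditive C] [Linear ℂ C]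
    [MonoidalCategory C] [SymmetricCategory C] where
  conj : C ⥤ C
  [braided : conj.Braided]
  map_add : ∀ {E F : C} (a b : E ⟶ F), conj.map (a + b) = conj.map a + conj.map b
  map_smul : ∀ {E F : C} (c : ℂ) (a : E ⟶ F),
    conj.map (c • a) = (starRingEnd ℂ c) • conj.map a
  conjConj : conj ⋙ conj ≅ 𝟭 C
  conjConj_monoidal : NatTrans.IsMonoidal conjConj.hom
  map_conjConj : ∀ E : C, conj.map (conjConj.hom.app E) = conjConj.hom.app (conj.obj E)

attribute [reducible, instance] AntiInvolution.braided

/-- The conjugation functor `E ↦ E^*`. -/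
abbrev conj (C : Type u₁) [Category.{v₁} C] [Preadditive C] [Linear ℂ C]
    [MonoidalCategory C] [SymmetricCategory C] [AntiInvolution C] : C ⥤ C :=
  AntiInvolution.conj

variable {C : Type u₁} [Category.{v₁} C] [Preadditive C] [Linear ℂ C]
    [MonoidalCategory C] [SymmetricCategory C] [AntiInvolution C]
  {D : Type u₂} [Category.{v₂} D] [Preadditive D] [Linear ℂ D]
    [MonoidalCategory D] [SymmetricCategory D] [AntiInvolution D]

/-- The extra structure that makes a symmetric tensor functor a tensor* functor: a tensor
isomorphism `F(E)^* ≅ F(E^*)` compatible with the anti-involutions. -/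
class StarFunctor (F : C ⥤ D) [F.Braided] where
  conjIso : F ⋙ conj D ≅ conj C ⋙ F
  monoidal : NatTrans.IsMonoidal conjIso.hom
  conjConj : ∀ E : C,
    (conj D).map (conjIso.hom.app E) ≫ conjIso.hom.app ((conj C).obj E) ≫
        F.map (AntiInvolution.conjConj.hom.app E) =
      AntiInvolution.conjConj.hom.app (F.obj E)

end TensorStar

/-! ### Fibred tensor categories -/

/-- A (complex, tensor*) fibred tensor category over smooth manifolds: a complex additive tensor*
category over every manifold, pull-back tensor* functors along smooth maps, and
coherent tensor* isomorphisms `f^* g^* ≅ (f ≫ g)^*` and `Id ≅ (𝟙 X)^*`.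
The composition constraint is indexed by factorizations `h = f ≫ g`. -/
structure FibredTensorCategory where
  obj : Mfd.{u} → Type v
  [category : ∀ X, Category.{w} (obj X)]
  [preadditive : ∀ X, Preadditive (obj X)]
  [linear : ∀ X, Linear ℂ (obj X)]
  [hasFiniteBiproducts : ∀ X, Limits.HasFiniteBiproducts (obj X)]
  [monoidalCategory : ∀ X, MonoidalCategory (obj X)]
  [symmetric : ∀ X, SymmetricCategory (obj X)]
  [monoidalPreadditive : ∀ X, MonoidalPreadditive (obj X)]
  [monoidalLinear : ∀ X, MonoidalLinear ℂ (obj X)]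
  [antiInvolution : ∀ X, AntiInvolution (obj X)]
  /-- Pull-back along a smooth map. -/
  pull : ∀ {X Y : Mfd.{u}}, (X ⟶ Y) → (obj Y ⥤ obj X)
  [pullAdditive : ∀ {X Y : Mfd.{u}} (f : X ⟶ Y), (pull f).Additive]
  [pullLinear : ∀ {X Y : Mfd.{u}} (f : X ⟶ Y), (pull f).Linear ℂ]
  [pullBraided : ∀ {X Y : Mfd.{u}} (f : X ⟶ Y), (pull f).Braided]
  [pullStar : ∀ {X Y : Mfd.{u}} (f : X ⟶ Y), StarFunctor (pull f)]
  pullComp : ∀ {X Y Z : Mfd.{u}} {f : X ⟶ Y} {g : Y ⟶ Z} {h : X ⟶ Z}, f ≫ g = h →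
    (pull g ⋙ pull f ≅ pull h)
  pullId : ∀ X : Mfd.{u}, 𝟭 (obj X) ≅ pull (𝟙 X)
  pullComp_monoidal : ∀ {X Y Z : Mfd.{u}} {f : X ⟶ Y} {g : Y ⟶ Z} {h : X ⟶ Z}
    (e : f ≫ g = h), NatTrans.IsMonoidal (pullComp e).hom
  pullId_monoidal : ∀ X : Mfd.{u}, NatTrans.IsMonoidal (pullId X).hom
  pullComp_star : ∀ {X Y Z : Mfd.{u}} {f : X ⟶ Y} {g : Y ⟶ Z} {h : X ⟶ Z}
    (e : f ≫ g = h) (E : obj Z),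
    (StarFunctor.conjIso (F := pull f)).hom.app ((pull g).obj E) ≫
        (pull f).map ((StarFunctor.conjIso (F := pull g)).hom.app E) ≫
        (pullComp e).hom.app ((conj (obj Z)).obj E) =
      (conj (obj X)).map ((pullComp e).hom.app E) ≫
        (StarFunctor.conjIso (F := pull h)).hom.app E
  pullId_star : ∀ (X : Mfd.{u}) (E : obj X),
    (pullId X).hom.app ((conj (obj X)).obj E) =
      (conj (obj X)).map ((pullId X).hom.app E) ≫
        (StarFunctor.conjIso (F := pull (𝟙 X))).hom.app E
  pullComp_assoc : ∀ {W X Y Z : Mfd.{u}} {f : W ⟶ X} {g : X ⟶ Y} {h : Y ⟶ Z}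
    {fg : W ⟶ Y} {gh : X ⟶ Z} {k : W ⟶ Z} (e₁ : f ≫ g = fg) (e₂ : g ≫ h = gh)
    (e₃ : fg ≫ h = k) (e₄ : f ≫ gh = k) (E : obj Z),
    (pull f).map ((pullComp e₂).hom.app E) ≫ (pullComp e₄).hom.app E =
      (pullComp e₁).hom.app ((pull h).obj E) ≫ (pullComp e₃).hom.app E
  pullId_comp : ∀ {X Y : Mfd.{u}} (f : X ⟶ Y) (E : obj Y),
    (pullId X).hom.app ((pull f).obj E) ≫ (pullComp (Category.id_comp f)).hom.app E =
      𝟙 ((pull f).obj E)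
  pullComp_id : ∀ {X Y : Mfd.{u}} (f : X ⟶ Y) (E : obj Y),
    (pull f).map ((pullId Y).hom.app E) ≫ (pullComp (Category.comp_id f)).hom.app E =
      𝟙 ((pull f).obj E)

attribute [instance] FibredTensorCategory.category FibredTensorCategory.preadditive
  FibredTensorCategory.linear FibredTensorCategory.hasFiniteBiproducts
  FibredTensorCategory.monoidalCategory FibredTensorCategory.symmetric
  FibredTensorCategory.monoidalPreadditive FibredTensorCategory.monoidalLinear
  FibredTensorCategory.antiInvolution FibredTensorCategory.pullAdditive
  FibredTensorCategory.pullLinear FibredTensorCategory.pullBraided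
  FibredTensorCategory.pullStar

namespace FibredTensorCategory

variable (𝓕 : FibredTensorCategory.{u, v, w})

/-- The pull-back along `g` of a morphism `f₁^* A ⟶ f₂^* B`, read as a morphism
`(g ≫ f₁)^* A ⟶ (g ≫ f₂)^* B` through the canonical identifications. For `f₁ = f₂` and `g`
inclusions of open subsets this is the restriction of morphisms. -/
def pullHom {Z W X₁ X₂ : Mfd.{u}} {g : Z ⟶ W} {f₁ : W ⟶ X₁} {f₂ : W ⟶ X₂} {h₁ : Z ⟶ X₁}
    {h₂ : Z ⟶ X₂} (e₁ : g ≫ f₁ = h₁) (e₂ : g ≫ f₂ = h₂) {A : 𝓕.obj X₁} {B : 𝓕.obj X₂}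
    (a : (𝓕.pull f₁).obj A ⟶ (𝓕.pull f₂).obj B) :
    (𝓕.pull h₁).obj A ⟶ (𝓕.pull h₂).obj B :=
  (𝓕.pullComp e₁).inv.app A ≫ (𝓕.pull g).map a ≫ (𝓕.pullComp e₂).hom.app B

/-- The prestack condition: for an open cover of a manifold, morphisms `E ⟶ F` are
uniquely determined by, and can be glued from, morphisms over the members of the cover
that agree on the overlaps. Applied to all open submanifolds, this says that
`U ↦ Hom(E|_U, F|_U)` is a sheaf. -/
structure IsPrestack : Prop where
  separated : ∀ (X : Mfd.{u}) (I : Type u) (U : I → Opens X), iSup U = ⊤ →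
    ∀ (E F : 𝓕.obj X) (a b : E ⟶ F),
      (∀ i, (𝓕.pull (Mfd.ι (U i))).map a = (𝓕.pull (Mfd.ι (U i))).map b) → a = b
  glue : ∀ (X : Mfd.{u}) (I : Type u) (U : I → Opens X), iSup U = ⊤ →
    ∀ (E F : 𝓕.obj X)
      (a : ∀ i, (𝓕.pull (Mfd.ι (U i))).obj E ⟶ (𝓕.pull (Mfd.ι (U i))).obj F),
      (∀ i j,
        𝓕.pullHom (Mfd.incl_ι (inf_le_left : U i ⊓ U j ≤ U i)) (Mfd.incl_ι _) (a i) =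
        𝓕.pullHom (Mfd.incl_ι (inf_le_right : U i ⊓ U j ≤ U j)) (Mfd.incl_ι _) (a j)) →
      ∃ b : E ⟶ F, ∀ i, (𝓕.pull (Mfd.ι (U i))).map b = a i

/-- The stack condition: a prestack in which every descent datum relative to an open cover
is effective. -/
structure IsStack : Prop extends 𝓕.IsPrestack where
  descent : ∀ (X : Mfd.{u}) (I : Type u) (U : I → Opens X), iSup U = ⊤ →
    ∀ (E : ∀ i, 𝓕.obj (X.ofOpens (U i)))
      (θ : ∀ i j, (𝓕.pull (Mfd.incl (inf_le_left : U i ⊓ U j ≤ U i))).obj (E i) ≅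
        (𝓕.pull (Mfd.incl (inf_le_right : U i ⊓ U j ≤ U j))).obj (E j)),
      (∀ i j k (hij : U i ⊓ U j ⊓ U k ≤ U i ⊓ U j) (hjk : U i ⊓ U j ⊓ U k ≤ U j ⊓ U k)
          (hik : U i ⊓ U j ⊓ U k ≤ U i ⊓ U k),
        𝓕.pullHom (Mfd.incl_incl hij _) (Mfd.incl_incl hij _) (θ i j).hom ≫
            𝓕.pullHom (Mfd.incl_incl hjk _) (Mfd.incl_incl hjk _) (θ j k).hom =
          𝓕.pullHom (Mfd.incl_incl hik _) (Mfd.incl_incl hik _) (θ i k).hom) →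
      ∃ (E₀ : 𝓕.obj X) (e : ∀ i, (𝓕.pull (Mfd.ι (U i))).obj E₀ ≅ E i),
        ∀ i j,
          (𝓕.pullComp (Mfd.incl_ι (inf_le_left : U i ⊓ U j ≤ U i))).inv.app E₀ ≫
              (𝓕.pull (Mfd.incl inf_le_left)).map (e i).hom ≫ (θ i j).hom =
            (𝓕.pullComp (Mfd.incl_ι (inf_le_right : U i ⊓ U j ≤ U j))).inv.app E₀ ≫
              (𝓕.pull (Mfd.incl inf_le_right)).map (e j).hom

end FibredTensorCategory

/-! ### Smooth tensor stacks -/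

/-- A smooth tensor stack: a tensor* stack over smooth manifolds together with an
identification, natural in the manifold, of the endomorphism algebra of the tensor unit
with the complex algebra of smooth functions. -/
structure SmoothTensorStack extends FibredTensorCategory.{u, v, w} where
  isStack : toFibredTensorCategory.IsStack
  fn : ∀ X : Mfd.{u}, End (𝟙_ (obj X)) ≃+* X.SmoothFn
  fn_const : ∀ (X : Mfd.{u}) (c : ℂ), fn X (c • 𝟙 (𝟙_ (obj X))) = ContMDiffMap.const c
  fn_pull : ∀ {X Y : Mfd.{u}} (f : X ⟶ Y) (a : 𝟙_ (obj Y) ⟶ 𝟙_ (obj Y)),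
    fn X (Functor.LaxMonoidal.ε (pull f) ≫ (pull f).map a ≫ Functor.OplaxMonoidal.η (pull f)) =
      (fn Y a).comp (Mfd.toMap f)

namespace SmoothTensorStack

variable (𝓕 : SmoothTensorStack.{u, v, w})

/-- The endomorphism of the tensor unit that corresponds to a smooth function. -/
def ofFn {X : Mfd.{u}} (c : X.SmoothFn) : 𝟙_ (𝓕.obj X) ⟶ 𝟙_ (𝓕.obj X) := (𝓕.fn X).symm c

variable {𝓕}

/-- The pull-back along `g` of a global section of `f^* E`, as a section of `(g ≫ f)^* E`. -/
def pullSec {Z Y X : Mfd.{u}} {g : Z ⟶ Y} {f : Y ⟶ X} {h : Z ⟶ X} (e : g ≫ f = h) {E : 𝓕.obj X}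
    (ζ : 𝟙_ (𝓕.obj Y) ⟶ (𝓕.pull f).obj E) : 𝟙_ (𝓕.obj Z) ⟶ (𝓕.pull h).obj E :=
  Functor.LaxMonoidal.ε (𝓕.pull g) ≫ (𝓕.pull g).map ζ ≫ (𝓕.pullComp e).hom.app E

/-- The sections `Γ E (U)` of an object `E` over an open subset `U`. -/
abbrev Sec {X : Mfd.{u}} (E : 𝓕.obj X) (U : Opens X) : Type w :=
  𝟙_ (𝓕.obj (X.ofOpens U)) ⟶ (𝓕.pull (Mfd.ι U)).obj E

/-- Restriction of sections. -/
def Sec.res {X : Mfd.{u}} {E : 𝓕.obj X} {U : Opens X} (ζ : Sec E U) {V : Opens X} (h : V ≤ U) :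
    Sec E V :=
  pullSec (Mfd.incl_ι h) ζ

/-- The product of a smooth function and a section. -/
def Sec.smul {X : Mfd.{u}} {E : 𝓕.obj X} {U : Opens X} (c : (X.ofOpens U).SmoothFn)
    (ζ : Sec E U) : Sec E U :=
  𝓕.ofFn c ≫ ζ

/-- The image of a section under a morphism: `[Γ a (U)] ζ`. -/
def Sec.map {X : Mfd.{u}} {E F : 𝓕.obj X} (a : E ⟶ F) {U : Opens X} (ζ : Sec E U) : Sec F U :=
  ζ ≫ (𝓕.pull (Mfd.ι U)).map a

/-- The section `ζ ⊗ ζ'` of `E ⊗ E'`. -/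
def Sec.tensor {X : Mfd.{u}} {E E' : 𝓕.obj X} {U : Opens X} (ζ : Sec E U) (ζ' : Sec E' U) :
    Sec (E ⊗ E') U :=
  (λ_ (𝟙_ (𝓕.obj (X.ofOpens U)))).inv ≫ (ζ ⊗ₘ ζ') ≫
    Functor.LaxMonoidal.μ (𝓕.pull (Mfd.ι U)) E E'

/-- For `f : X ⟶ Y`, a section `η` of `F` over `V` and an open `U` with `f(U) ⊆ V`
(`g` being the map `U → V` induced by `f`), the section `η ∘ f` of `f^* F` over `U`. -/
def Sec.compMap {X Y : Mfd.{u}} (f : X ⟶ Y) {F : 𝓕.obj Y} {V : Opens Y} (η : Sec F V)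
    {U : Opens X} (g : X.ofOpens U ⟶ Y.ofOpens V) (hg : g ≫ Mfd.ι V = Mfd.ι U ≫ f) :
    Sec ((𝓕.pull f).obj F) U :=
  pullSec hg η ≫ (𝓕.pullComp (rfl : Mfd.ι U ≫ f = Mfd.ι U ≫ f)).inv.app F

/-- The vector space `E_*` attached to an object over the one-point manifold. -/
abbrev Star (E : 𝓕.obj Mfd.pt.{u}) : Type w := 𝟙_ (𝓕.obj Mfd.pt.{u}) ⟶ E

/-- The canonical map `E_* ⊗ F_* → (E ⊗ F)_*`. -/
def starTensor (E F : 𝓕.obj Mfd.pt.{u}) :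
    TensorProduct ℂ (Star E) (Star F) →ₗ[ℂ] Star (E ⊗ F) :=
  TensorProduct.lift (LinearMap.mk₂ ℂ
    (fun (v : Star E) (w : Star F) => (λ_ (𝟙_ (𝓕.obj Mfd.pt.{u}))).inv ≫ (v ⊗ₘ w))
    (fun v v' w => by simp [MonoidalPreadditive.add_tensor])
    (fun c v w => by simp [MonoidalCategory.tensorHom_def])
    (fun v w w' => by simp [MonoidalPreadditive.tensor_add])
    (fun c v w => by simp [MonoidalCategory.tensorHom_def]))

/-- The canonical map `ℂ → 𝟙_*`. -/
def starUnit (𝓕 : SmoothTensorStack.{u, v, w}) (c : ℂ) : Star (𝟙_ (𝓕.obj Mfd.pt.{u})) :=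
  c • 𝟙 (𝟙_ (𝓕.obj Mfd.pt.{u}))

/-- The fibre `E_x = (x^* E)_*`. -/
abbrev Fibre {X : Mfd.{u}} (E : 𝓕.obj X) (x : X) : Type w := Star ((𝓕.pull (Mfd.point x)).obj E)

/-- The linear map `a_x : E_x → F_x` induced by a morphism `a : E ⟶ F`. -/
def fibreMap {X : Mfd.{u}} {E F : 𝓕.obj X} (a : E ⟶ F) (x : X) : Fibre E x →ₗ[ℂ] Fibre F x :=
  Linear.rightComp ℂ _ ((𝓕.pull (Mfd.point x)).map a)

/-- The value `ζ(x) ∈ E_x` of a section `ζ` of `E` over `U` at a point `x` of `U`. -/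
def Sec.eval {X : Mfd.{u}} {E : 𝓕.obj X} {U : Opens X} (ζ : Sec E U) (x : X) (hx : x ∈ U) :
    Fibre E x :=
  pullSec (Mfd.point_ι U x hx) ζ

/-- The identification `(𝟙_)_* ≅ ℂ`. -/
def scalar (a : Star (𝟙_ (𝓕.obj Mfd.pt.{u}))) : ℂ := 𝓕.fn Mfd.pt a PUnit.unit

/-- The canonical antilinear map `E_x → (E^*)_x`. -/
def fibreConj {X : Mfd.{u}} {E : 𝓕.obj X} {x : X} (v : Fibre E x) :
    Fibre ((conj (𝓕.obj X)).obj E) x :=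
  Functor.LaxMonoidal.ε (conj (𝓕.obj Mfd.pt)) ≫ (conj (𝓕.obj Mfd.pt)).map v ≫
    (StarFunctor.conjIso (F := 𝓕.pull (Mfd.point x))).hom.app E

/-- The form on the fibre `E_x` induced by a form `φ : E ⊗ E^* ⟶ 𝟙_`, namely
`E_x ⊗ E_x^* → (E ⊗ E^*)_x → (𝟙_)_x ≅ ℂ`. It is linear in `v` and antilinear in `w`. -/
def fibreForm {X : Mfd.{u}} {E : 𝓕.obj X} (φ : E ⊗ (conj (𝓕.obj X)).obj E ⟶ 𝟙_ (𝓕.obj X)) (x : X)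
    (v w : Fibre E x) : ℂ :=
  scalar ((λ_ (𝟙_ (𝓕.obj Mfd.pt))).inv ≫ (v ⊗ₘ fibreConj w) ≫
    Functor.LaxMonoidal.μ (𝓕.pull (Mfd.point x)) E ((conj (𝓕.obj X)).obj E) ≫
    (𝓕.pull (Mfd.point x)).map φ ≫ Functor.OplaxMonoidal.η (𝓕.pull (Mfd.point x)))

/-- `φ` is a metric on `E`: the induced form on every fibre is Hermitian and positive definite. -/
def IsMetric {X : Mfd.{u}} {E : 𝓕.obj X} (φ : E ⊗ (conj (𝓕.obj X)).obj E ⟶ 𝟙_ (𝓕.obj X)) : Prop :=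
  ∀ x : X, (∀ v w : Fibre E x, fibreForm φ x w v = (starRingEnd ℂ) (fibreForm φ x v w)) ∧
    ∀ v : Fibre E x, v ≠ 0 → 0 < (fibreForm φ x v v).re

/-- A morphism of sheaves of `C^∞`-modules `Γ E → Γ F`. -/
structure SheafHom {X : Mfd.{u}} (E F : 𝓕.obj X) where
  app : ∀ U : Opens X, Sec E U → Sec F U
  map_add : ∀ (U : Opens X) (ζ ζ' : Sec E U), app U (ζ + ζ') = app U ζ + app U ζ'
  map_smul : ∀ (U : Opens X) (c : (X.ofOpens U).SmoothFn) (ζ : Sec E U),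
    app U (Sec.smul c ζ) = Sec.smul c (app U ζ)
  map_res : ∀ {U V : Opens X} (h : V ≤ U) (ζ : Sec E U), app V (ζ.res h) = (app U ζ).res h

/-- A morphism of sheaves `Γ E → Γ F` is representable if it is compatible, through evaluation,
with a family of linear maps between the fibres. -/
def SheafHom.IsRepresentable {X : Mfd.{u}} {E F : 𝓕.obj X} (α : SheafHom E F) : Prop :=
  ∃ a : ∀ x : X, Fibre E x →ₗ[ℂ] Fibre F x,
    ∀ (U : Opens X) (ζ : Sec E U) (x : X) (hx : x ∈ U),
      (α.app U ζ).eval x hx = a x (ζ.eval x hx)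

/-- `E` is locally finite: locally, `Γ E` is generated by finitely many sections as a sheaf of
`C^∞`-modules. -/
def IsLocallyFinite {X : Mfd.{u}} (E : 𝓕.obj X) : Prop :=
  ∀ x : X, ∃ U : Opens X, x ∈ U ∧ ∃ (n : ℕ) (ζ : Fin n → Sec E U),
    ∀ (V : Opens X) (hVU : V ≤ U) (θ : Sec E V), ∀ y ∈ V,
      ∃ (W : Opens X) (hWV : W ≤ V), y ∈ W ∧ ∃ c : Fin n → (X.ofOpens W).SmoothFn,
        θ.res hWV = ∑ k, Sec.smul (c k) ((ζ k).res (hWV.trans hVU))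

/-- `E` is locally free of locally finite rank: locally it is isomorphic to a finite direct sum of
copies of the tensor unit. -/
def IsLocallyFree {X : Mfd.{u}} (E : 𝓕.obj X) : Prop :=
  ∀ x : X, ∃ U : Opens X, x ∈ U ∧ ∃ d : ℕ,
    Nonempty ((𝓕.pull (Mfd.ι U)).obj E ≅ ⨁ fun _ : Fin d => 𝟙_ (𝓕.obj (X.ofOpens U)))

/-- A smooth tensor stack is Euclidean if it satisfies the axioms below. -/
structure IsEuclidean (𝓕 : SmoothTensorStack.{u, v, w}) : Prop where
  /-- `Γ E ⊗ Γ E' → Γ (E ⊗ E')` is an epimorphism of sheaves: its image consists of the sections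
  that are locally finite sums of `c • (ζ ⊗ ζ')`. -/
  tensor_surjective : ∀ {X : Mfd.{u}} (E E' : 𝓕.obj X) (U : Opens X) (θ : Sec (E ⊗ E') U),
    ∀ x ∈ U, ∃ (V : Opens X) (hVU : V ≤ U), x ∈ V ∧
      ∃ (n : ℕ) (c : Fin n → (X.ofOpens V).SmoothFn) (ζ : Fin n → Sec E V) (ζ' : Fin n → Sec E' V),
        θ.res hVU = ∑ k, Sec.smul (c k) ((ζ k).tensor (ζ' k))
  /-- `f^* (Γ F) → Γ (f^* F)` is an epimorphism of sheaves: its image consists of the sections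
  that are locally finite sums of `c • (η ∘ f)`. -/
  pull_surjective : ∀ {X Y : Mfd.{u}} (f : X ⟶ Y) (F : 𝓕.obj Y) (U : Opens X)
    (θ : Sec ((𝓕.pull f).obj F) U), ∀ x ∈ U,
      ∃ (U' : Opens X) (hU : U' ≤ U) (V : Opens Y) (g : X.ofOpens U' ⟶ Y.ofOpens V)
        (hg : g ≫ Mfd.ι V = Mfd.ι U' ≫ f), x ∈ U' ∧
        ∃ (n : ℕ) (c : Fin n → (X.ofOpens U').SmoothFn) (η : Fin n → Sec F V),
          θ.res hU = ∑ k, Sec.smul (c k) ((η k).compMap f g hg)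
  /-- Criterion for vanishing. -/
  vanishing : ∀ {X : Mfd.{u}} {E E' : 𝓕.obj X} (a : E ⟶ E'), (∀ x, fibreMap a x = 0) → a = 0
  /-- Representable morphisms of sheaves come from morphisms of objects. -/
  representable : ∀ {X : Mfd.{u}} {E F : 𝓕.obj X} (α : SheafHom E F), α.IsRepresentable →
    ∃ a : E ⟶ F, ∀ (U : Opens X) (ζ : Sec E U), ζ.map a = α.app U ζ
  /-- Existence of local metrics. -/
  local_metrics : ∀ {X : Mfd.{u}} (E : 𝓕.obj X) (x : X), ∃ U : Opens X, x ∈ U ∧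
    ∃ φ : (𝓕.pull (Mfd.ι U)).obj E ⊗
        (conj (𝓕.obj (X.ofOpens U))).obj ((𝓕.pull (Mfd.ι U)).obj E) ⟶ 𝟙_ (𝓕.obj (X.ofOpens U)),
      IsMetric φ
  /-- Dimension: the functor `E ↦ E_*` over the one-point manifold is full. -/
  star_full : ((linearCoyoneda ℂ (𝓕.obj Mfd.pt.{u})).obj (Opposite.op (𝟙_ _))).Full
  /-- Dimension: the functor `E ↦ E_*` over the one-point manifold is faithful. -/
  star_faithful : ((linearCoyoneda ℂ (𝓕.obj Mfd.pt.{u})).obj (Opposite.op (𝟙_ _))).Faithful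
  /-- Dimension: `E_*` is finite dimensional. -/
  star_finite : ∀ E : 𝓕.obj Mfd.pt.{u}, Module.Finite ℂ (Star E)
  /-- Dimension: `E_* ⊗ F_* ≅ (E ⊗ F)_*`. -/
  star_tensor : ∀ E F : 𝓕.obj Mfd.pt.{u}, Function.Bijective (starTensor E F)
  /-- Dimension: `ℂ ≅ 𝟙_*`. -/
  star_unit : Function.Bijective (starUnit 𝓕)
  /-- Local finiteness. -/
  locally_finite : ∀ {X : Mfd.{u}} (E : 𝓕.obj X), IsLocallyFinite E

end SmoothTensorStack

end

/-! The problem is local. By the vanishing axiom a morphism is determined by its maps on fibres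
(`IsEuclidean.hom_ext`), so given local extensions `a x` of `a'` over open sets `U x` and a
subordinate smooth partition of unity `ρ`, the fibrewise sum of `ρ x • a x` is locally a morphism,
and the prestack condition glues it to a global one. On fibres over `S` each summand is `ρ x • a'`,
and the weights sum to 1 (`IsEuclidean.exists_extension_of_locally`). Off the closed set `S`, zero
serves as local extension.

Near a point `s₀` of `S`, choose a frame of `E|_S`. Sections of `i^* E` extend locally to `X`: by
the epimorphism axiom for pull-backs they are combinations of sections that already come from `X`,
and the coefficients extend by composition with a local smooth retraction onto `S`
(`IsEuclidean.exists_sec_extension`). Thus the frame extends to sections `ζ k` of `E`, and its image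
under `a'` to sections `θ k` of `F`.

Since `E` need not be locally free on `X`, a morphism with `ζ k ↦ θ k` cannot be read off from a
basis. A local metric replaces the dual basis: the `ζ k` are independent at `s₀`, so their Gram
matrix `G` is invertible there, hence nearby. With `q l` the pairing with `ζ l`, the morphism `∑ q l
· (G⁻¹) l k · θ k` sends each `ζ k` to `θ k` (`IsEuclidean.exists_hom_of_linearIndependent`). Over
`S` the `ζ k` form the frame, so this morphism restricts to `a'`. -/

namespace FibredTensorCategory

variable {𝓕 : FibredTensorCategory.{u, v, w}}

/-! ### Coherence of pull-back for morphisms -/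

section PullHom

variable {Z W X₁ X₂ : Mfd.{u}} {g : Z ⟶ W} {f₁ : W ⟶ X₁} {f₂ : W ⟶ X₂}
  {h₁ : Z ⟶ X₁} {h₂ : Z ⟶ X₂} (e₁ : g ≫ f₁ = h₁) (e₂ : g ≫ f₂ = h₂)
  {A : 𝓕.obj X₁} {B : 𝓕.obj X₂}

lemma pullHom_add (a b : (𝓕.pull f₁).obj A ⟶ (𝓕.pull f₂).obj B) :
    𝓕.pullHom e₁ e₂ (a + b) = 𝓕.pullHom e₁ e₂ a + 𝓕.pullHom e₁ e₂ b := by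
  simp [pullHom, Functor.map_add]

/-- Pull-back of morphisms as a homomorphism of groups. -/
def pullHomAddHom : ((𝓕.pull f₁).obj A ⟶ (𝓕.pull f₂).obj B) →+
    ((𝓕.pull h₁).obj A ⟶ (𝓕.pull h₂).obj B) :=
  AddMonoidHom.mk' (𝓕.pullHom e₁ e₂) (pullHom_add e₁ e₂)

lemma pullHom_sum {ι : Type*} (s : Finset ι)
    (a : ι → ((𝓕.pull f₁).obj A ⟶ (𝓕.pull f₂).obj B)) :
    𝓕.pullHom e₁ e₂ (∑ k ∈ s, a k) = ∑ k ∈ s, 𝓕.pullHom e₁ e₂ (a k) :=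
  map_sum (pullHomAddHom e₁ e₂) a s

lemma map_eq_of_pullHom_eq {a b : (𝓕.pull f₁).obj A ⟶ (𝓕.pull f₂).obj B}
    (hab : 𝓕.pullHom e₁ e₂ a = 𝓕.pullHom e₁ e₂ b) : (𝓕.pull g).map a = (𝓕.pull g).map b :=
  (cancel_mono ((𝓕.pullComp e₂).hom.app B)).1 ((cancel_epi ((𝓕.pullComp e₁).inv.app A)).1 hab)

/-- Associativity of the composition constraints at source and target, plus naturality. This allows
the fibre map at a point to be computed through any intermediate open subset. -/
lemma pullHom_pullHom {Y : Mfd.{u}} {k : Y ⟶ Z} {m : Y ⟶ W} {l₁ : Y ⟶ X₁} {l₂ : Y ⟶ X₂}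
    (ek : k ≫ g = m) (d₁ : k ≫ h₁ = l₁) (d₂ : k ≫ h₂ = l₂) (c₁ : m ≫ f₁ = l₁) (c₂ : m ≫ f₂ = l₂)
    (a : (𝓕.pull f₁).obj A ⟶ (𝓕.pull f₂).obj B) :
    𝓕.pullHom d₁ d₂ (𝓕.pullHom e₁ e₂ a) = 𝓕.pullHom c₁ c₂ a := by
  have hA := 𝓕.pullComp_assoc ek e₁ c₁ d₁ A
  have hB := 𝓕.pullComp_assoc ek e₂ c₂ d₂ B
  have hA' : (𝓕.pullComp d₁).inv.app A ≫ (𝓕.pull k).map ((𝓕.pullComp e₁).inv.app A) =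
      (𝓕.pullComp c₁).inv.app A ≫ (𝓕.pullComp ek).inv.app ((𝓕.pull f₁).obj A) := by
    rw [← cancel_epi ((𝓕.pullComp c₁).hom.app A),
      ← cancel_epi ((𝓕.pullComp ek).hom.app ((𝓕.pull f₁).obj A))]
    have : (𝓕.pull k).map ((𝓕.pullComp e₁).hom.app A) ≫
        (𝓕.pull k).map ((𝓕.pullComp e₁).inv.app A) = 𝟙 _ := by
      rw [← Functor.map_comp, Iso.hom_inv_id_app]
      exact CategoryTheory.Functor.map_id _ _
    rw [← reassoc_of% hA]
    simp [this]
  simp only [pullHom, Functor.map_comp, Category.assoc]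
  rw [hB, reassoc_of% hA']
  have := (𝓕.pullComp ek).hom.naturality a
  simp only [Functor.comp_map] at this
  rw [reassoc_of% this]
  simp

end PullHom

lemma pullHom_map {Z W X : Mfd.{u}} {g : Z ⟶ W} {f : W ⟶ X} {h : Z ⟶ X} (e : g ≫ f = h)
    {A B : 𝓕.obj X} (a : A ⟶ B) : 𝓕.pullHom e e ((𝓕.pull f).map a) = (𝓕.pull h).map a := by
  have := (𝓕.pullComp e).hom.naturality a
  simp only [Functor.comp_map] at this
  simp [pullHom, this]

end FibredTensorCategory

namespace SmoothTensorStack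

open FibredTensorCategory

variable {𝓕 : SmoothTensorStack.{u, v, w}}

/-! ### Coherence of pull-back for sections -/

section PullSec

variable {Z W X₁ X₂ : Mfd.{u}} {g : Z ⟶ W} {f₁ : W ⟶ X₁} {f₂ : W ⟶ X₂}
  {h₁ : Z ⟶ X₁} {h₂ : Z ⟶ X₂} (e₁ : g ≫ f₁ = h₁) (e₂ : g ≫ f₂ = h₂)
  {A : 𝓕.obj X₁} {B : 𝓕.obj X₂}

lemma pullSec_comp_pullHom (ζ : 𝟙_ (𝓕.obj W) ⟶ (𝓕.pull f₁).obj A)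
    (a : (𝓕.pull f₁).obj A ⟶ (𝓕.pull f₂).obj B) :
    pullSec e₁ ζ ≫ 𝓕.pullHom e₁ e₂ a = pullSec e₂ (ζ ≫ a) := by
  simp [pullHom, pullSec]

lemma pullSec_add (ζ ζ' : 𝟙_ (𝓕.obj W) ⟶ (𝓕.pull f₁).obj A) :
    pullSec e₁ (ζ + ζ') = pullSec e₁ ζ + pullSec e₁ ζ' := by
  simp [pullSec, Functor.map_add]

/-- Pull-back of sections as a homomorphism of groups. -/
def pullSecAddHom : (𝟙_ (𝓕.obj W) ⟶ (𝓕.pull f₁).obj A) →+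
    (𝟙_ (𝓕.obj Z) ⟶ (𝓕.pull h₁).obj A) :=
  AddMonoidHom.mk' (pullSec e₁) (pullSec_add e₁)

lemma pullSec_sum {ι : Type*} (s : Finset ι) (ζ : ι → (𝟙_ (𝓕.obj W) ⟶ (𝓕.pull f₁).obj A)) :
    pullSec e₁ (∑ k ∈ s, ζ k) = ∑ k ∈ s, pullSec e₁ (ζ k) :=
  map_sum (pullSecAddHom e₁) ζ s

lemma ε_pullComp {Y : Mfd.{u}} {k : Y ⟶ Z} {m : Y ⟶ W} (ek : k ≫ g = m) :
    Functor.LaxMonoidal.ε (𝓕.pull k) ≫ (𝓕.pull k).map (Functor.LaxMonoidal.ε (𝓕.pull g)) ≫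
      (𝓕.pullComp ek).hom.app (𝟙_ _) = Functor.LaxMonoidal.ε (𝓕.pull m) := by
  have := (𝓕.pullComp_monoidal ek).unit
  simpa using this

lemma pullSec_pullSec {Y : Mfd.{u}} {k : Y ⟶ Z} {m : Y ⟶ W} {l₁ : Y ⟶ X₁}
    (ek : k ≫ g = m) (d₁ : k ≫ h₁ = l₁) (c₁ : m ≫ f₁ = l₁)
    (ζ : 𝟙_ (𝓕.obj W) ⟶ (𝓕.pull f₁).obj A) :
    pullSec d₁ (pullSec e₁ ζ) = pullSec c₁ ζ := by
  have hA := 𝓕.pullComp_assoc ek e₁ c₁ d₁ A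
  have := (𝓕.pullComp ek).hom.naturality ζ
  simp only [Functor.comp_map] at this
  simp only [pullSec, Functor.map_comp, Category.assoc, ← ε_pullComp ek]
  rw [hA, reassoc_of% this]

/-- The canonical isomorphism `E_{f(y)} ≅ (f^* E)_y` is compatible with values of sections. -/
lemma pullSec_comp_pullComp_hom {Y : Mfd.{u}} {k : Y ⟶ Z} {l : Y ⟶ W} {m : Y ⟶ X₁}
    (d : k ≫ g = l) (c : l ≫ f₁ = m) (b : k ≫ h₁ = m)
    (ζ : 𝟙_ (𝓕.obj Z) ⟶ (𝓕.pull g).obj ((𝓕.pull f₁).obj A)) :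
    pullSec d ζ ≫ (𝓕.pullComp c).hom.app A =
      pullSec b (ζ ≫ (𝓕.pullComp e₁).hom.app A) := by
  have hA := 𝓕.pullComp_assoc d e₁ c b A
  simp only [pullSec, Functor.map_comp, Category.assoc]
  rw [hA]

end PullSec

/-! ### Smooth functions as endomorphisms of the unit, and their action on morphisms -/

section Functions

lemma ε_map_η_comp {Z W : Mfd.{u}} (g : Z ⟶ W) (f : W.SmoothFn) :
    Functor.LaxMonoidal.ε (𝓕.pull g) ≫ (𝓕.pull g).map (𝓕.ofFn f) ≫
      Functor.OplaxMonoidal.η (𝓕.pull g) = 𝓕.ofFn (f.comp (Mfd.toMap g)) := by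
  apply (𝓕.fn Z).injective
  rw [𝓕.fn_pull]
  simp [ofFn]

lemma ε_map_ofFn {Z W : Mfd.{u}} (g : Z ⟶ W) (f : W.SmoothFn) :
    Functor.LaxMonoidal.ε (𝓕.pull g) ≫ (𝓕.pull g).map (𝓕.ofFn f) =
      𝓕.ofFn (f.comp (Mfd.toMap g)) ≫ Functor.LaxMonoidal.ε (𝓕.pull g) := by
  simp [← ε_map_η_comp]

lemma ofFn_const {X : Mfd.{u}} (c : ℂ) :
    𝓕.ofFn (ContMDiffMap.const c : X.SmoothFn) = c • 𝟙 (𝟙_ (𝓕.obj X)) := by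
  apply (𝓕.fn X).injective
  rw [𝓕.fn_const]
  simp [ofFn]

lemma ofFn_mul {X : Mfd.{u}} (c d : X.SmoothFn) : 𝓕.ofFn (c * d) = 𝓕.ofFn c ≫ 𝓕.ofFn d := by
  -- The product in `End` is composition in the opposite order.
  rw [mul_comm]
  exact map_mul (𝓕.fn X).symm d c

lemma ofFn_zero {X : Mfd.{u}} : 𝓕.ofFn (0 : X.SmoothFn) = 0 := map_zero (𝓕.fn X).symm

lemma ofFn_sum {X : Mfd.{u}} {ι : Type*} (s : Finset ι) (c : ι → X.SmoothFn) :
    𝓕.ofFn (∑ k ∈ s, c k) = ∑ k ∈ s, 𝓕.ofFn (c k) := map_sum (𝓕.fn X).symm c s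

lemma ofFn_fn {X : Mfd.{u}} (c : 𝟙_ (𝓕.obj X) ⟶ 𝟙_ (𝓕.obj X)) : 𝓕.ofFn (𝓕.fn X c) = c :=
  (𝓕.fn X).symm_apply_apply c

lemma ofFn_pt (c : Mfd.pt.{u}.SmoothFn) : 𝓕.ofFn c = c PUnit.unit • 𝟙 (𝟙_ (𝓕.obj Mfd.pt)) := by
  rw [← ofFn_const]
  congr 1

lemma ofFn_comp_point {X : Mfd.{u}} (x : X) (c : X.SmoothFn) :
    𝓕.ofFn (c.comp (Mfd.toMap (Mfd.point x))) = c x • 𝟙 (𝟙_ (𝓕.obj Mfd.pt)) := by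
  rw [ofFn_pt]
  rfl

lemma map_point_ofFn {X : Mfd.{u}} (x : X) (c : X.SmoothFn) :
    (𝓕.pull (Mfd.point x)).map (𝓕.ofFn c) = c x • 𝟙 _ := by
  rw [← cancel_epi (Functor.LaxMonoidal.ε (𝓕.pull (Mfd.point x))), ε_map_ofFn, ofFn_comp_point]
  simp

lemma scalar_smul_id (c : ℂ) : scalar (c • 𝟙 (𝟙_ (𝓕.obj Mfd.pt.{u}))) = c := by
  simp only [scalar, 𝓕.fn_const]
  rfl

lemma scalar_smul_eq (a : Star (𝟙_ (𝓕.obj Mfd.pt.{u}))) : scalar a • 𝟙 (𝟙_ (𝓕.obj Mfd.pt)) = a := by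
  rw [scalar, ← ofFn_pt, ofFn_fn]

/-- The product of a smooth function and a morphism. -/
noncomputable def homSMul {X : Mfd.{u}} {E F : 𝓕.obj X} (c : X.SmoothFn) (a : E ⟶ F) : E ⟶ F :=
  (λ_ E).inv ≫ (𝓕.ofFn c ▷ E) ≫ (λ_ E).hom ≫ a

lemma map_point_homSMul {X : Mfd.{u}} {E F : 𝓕.obj X} (x : X) (c : X.SmoothFn) (a : E ⟶ F) :
    (𝓕.pull (Mfd.point x)).map (homSMul c a) = c x • (𝓕.pull (Mfd.point x)).map a := by
  have : (𝓕.pull (Mfd.point x)).map (𝓕.ofFn c ▷ E) = c x • 𝟙 _ := by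
    rw [Functor.Monoidal.map_whiskerRight, map_point_ofFn]
    simp
  simp only [homSMul, Functor.map_comp, this, Linear.smul_comp, Linear.comp_smul, Category.id_comp]
  simp [← Functor.map_comp]

end Functions

end SmoothTensorStack

/-! ### Local retractions and partitions of unity -/

namespace Mfd

open Topology

/-- A closed submanifold is, locally, a smooth retract. -/
lemma IsClosedSubmanifold.exists_retraction {S X : Mfd.{u}} {i : S ⟶ X}
    (hi : IsClosedSubmanifold i) (s₀ : S) (A : Opens S) (hs₀ : s₀ ∈ A) (V : Opens X)
    (hV : toMap i s₀ ∈ V) :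
    ∃ (W : Opens X) (_ : W ≤ V) (r : X.ofOpens W ⟶ S.ofOpens A), toMap i s₀ ∈ W ∧
      ∀ (s : S) (hs : toMap i s ∈ W), toMap (r ≫ ι A) (⟨toMap i s, hs⟩ : W) = s := by
  have h := hi.1.isImmersion.isImmersionAt s₀
  set φ : OpenPartialHomeomorph S (EuclideanSpace ℝ (Fin S.dim)) := h.domChart with hφ
  set ψ : OpenPartialHomeomorph X (EuclideanSpace ℝ (Fin X.dim)) := h.codChart with hψ
  -- Since `i` is an embedding and not only an immersion, a small open set of `X` meets the image of
  -- `S` only in points of `A` inside the chart; no other part of `S` comes back near `i s₀`.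
  obtain ⟨O, hO, hOA⟩ := hi.1.isEmbedding.isOpen_iff.1 (A.isOpen.inter φ.open_source)
  have hmemO : ∀ s, toMap i s ∈ O ↔ s ∈ A ∧ s ∈ φ.source := fun s => by
    have := congrArg (s ∈ ·) hOA
    simpa using this
  -- the coordinate expression of the retraction
  let q : X → EuclideanSpace ℝ (Fin S.dim) := fun y => (h.equiv.symm (ψ y)).1
  have hq : ContMDiffOn (𝓡 X.dim) (𝓡 S.dim) ∞ q ψ.source := by
    have h1 : ContMDiffOn (𝓡 X.dim) (𝓡 X.dim) ∞ ψ ψ.source :=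
      contMDiffOn_of_mem_maximalAtlas h.codChart_mem_maximalAtlas
    have h2 : ContDiff ℝ ∞ (fun z : EuclideanSpace ℝ (Fin X.dim) => (h.equiv.symm z).1) :=
      contDiff_fst.comp h.equiv.symm.contDiff
    exact h2.contMDiff.comp_contMDiffOn h1
  have hqi : ∀ s ∈ φ.source, q (toMap i s) = φ s := by
    intro s hs
    have hs' : φ s ∈ (h.domChart.extend (𝓡 S.dim)).target := by
      rw [OpenPartialHomeomorph.extend_target]
      simpa using φ.map_source hs
    -- In the immersion charts `i` reads `v ↦ (v, 0)`, so the first component recovers `φ s`.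
    have := h.writtenInCharts hs'
    simp only [Function.comp_apply, OpenPartialHomeomorph.extend_coe,
      OpenPartialHomeomorph.extend_coe_symm, modelWithCornersSelf_coe, id_eq,
      modelWithCornersSelf_coe_symm, ← hφ, ← hψ, φ.left_inv hs] at this
    simp only [q]
    erw [this]
    simp
  have hT : IsOpen (φ.target ∩ φ.symm ⁻¹' A) :=
    φ.symm.continuousOn.isOpen_inter_preimage φ.open_target A.isOpen
  have hW : IsOpen (ψ.source ∩ q ⁻¹' (φ.target ∩ φ.symm ⁻¹' A)) :=
    hq.continuousOn.isOpen_inter_preimage ψ.open_source hT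
  -- The last factor makes `φ.symm ∘ q` defined with values in `A`.
  let W : Opens X := ⟨V ∩ (O ∩ (ψ.source ∩ q ⁻¹' (φ.target ∩ φ.symm ⁻¹' A))),
    V.isOpen.inter (hO.inter hW)⟩
  have hr : ContMDiff (𝓡 X.dim) (𝓡 S.dim) ∞ (fun y : W => φ.symm (q y)) := by
    have h1 : ContMDiffOn (𝓡 S.dim) (𝓡 S.dim) ∞ φ.symm φ.target :=
      contMDiffOn_symm_of_mem_maximalAtlas h.domChart_mem_maximalAtlas
    have h2 : ContMDiff (𝓡 X.dim) (𝓡 S.dim) ∞ (fun y : W => q y) := by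
      rw [← contMDiffOn_univ]
      exact hq.comp contMDiff_subtype_val.contMDiffOn (fun y _ => y.2.2.2.1)
    rw [← contMDiffOn_univ]
    exact h1.comp h2.contMDiffOn (fun y _ => y.2.2.2.2.1)
  have hr' : ContMDiff (𝓡 X.dim) (𝓡 S.dim) ∞
      (fun y : W => (⟨φ.symm (q y), y.2.2.2.2.2⟩ : A)) :=
    (ContMDiff.subtypeVal_comp_iff A _).1 hr
  refine ⟨W, fun y hy => hy.1, (⟨_, hr'⟩ : C^∞⟮𝓡 X.dim, W; 𝓡 S.dim, A⟯), ?_, ?_⟩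
  · have hs : s₀ ∈ φ.source := h.mem_domChart_source
    refine ⟨hV, (hmemO s₀).2 ⟨hs₀, hs⟩, h.mem_codChart_source, ?_⟩
    rw [Set.mem_preimage, hqi s₀ hs]
    exact ⟨φ.map_source hs, by simpa [φ.left_inv hs] using hs₀⟩
  · intro s hs
    have hs' : s ∈ φ.source := ((hmemO s).1 hs.2.1).2
    change φ.symm (q (toMap i s)) = s
    rw [hqi s hs', φ.left_inv hs']

/-- On a manifold, a compact set and an open neighbourhood of it are separated by a smooth
function. -/
lemma exists_smooth_pos_of_isCompact {X : Mfd.{u}} {K : Set X} (hK : IsCompact K) {U : Set X}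
    (hU : IsOpen U) (hKU : K ⊆ U) :
    ∃ f : C^∞⟮𝓡 X.dim, X; 𝓘(ℝ, ℝ), ℝ⟯, (∀ x, 0 ≤ f x) ∧ (∀ x ∈ K, 0 < f x) ∧ tsupport f ⊆ U := by
  have hloc : ∀ x ∈ K, ∃ f : SmoothBumpFunction (𝓡 X.dim) x, tsupport f ⊆ U := by
    intro x hx
    obtain ⟨f, -, hf⟩ := (SmoothBumpFunction.nhds_basis_tsupport (I := 𝓡 X.dim) x).mem_iff.1
      (hU.mem_nhds (hKU hx))
    exact ⟨f, hf⟩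
  choose! b hb using hloc
  obtain ⟨t, htK, ht⟩ := hK.elim_nhds_subcover (fun x => Function.support (b x))
    (fun x _ => (b x).support_mem_nhds)
  have hsm : ∀ x, ContMDiff (𝓡 X.dim) 𝓘(ℝ, ℝ) ∞ (b x) := fun x => (b x).contMDiff
  refine ⟨⟨fun y => ∑ x ∈ t, b x y, contMDiff_finsetSum fun x _ => hsm x⟩, ?_, ?_, ?_⟩
  · exact fun y => Finset.sum_nonneg fun x _ => (b x).nonneg
  · intro y hy
    obtain ⟨x, hxt, hyx⟩ := Set.mem_iUnion₂.1 (ht hy)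
    exact Finset.sum_pos' (fun x _ => (b x).nonneg)
      ⟨x, hxt, lt_of_le_of_ne (b x).nonneg (Ne.symm hyx)⟩
  · have hcl : IsClosed (⋃ x ∈ t, tsupport (b x)) :=
      t.finite_toSet.isClosed_biUnion fun x _ => isClosed_tsupport _
    refine (closure_minimal ?_ hcl).trans (Set.iUnion₂_subset fun x hx => hb x (htK x hx))
    intro y hy
    obtain ⟨x, hxt, hyx⟩ := Finset.exists_ne_zero_of_sum_ne_zero hy
    exact Set.mem_iUnion₂.2 ⟨x, hxt, subset_tsupport _ hyx⟩

/-- Smooth partitions of unity on a paracompact manifold. -/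
lemma exists_smoothPartitionOfUnity (X : Mfd.{u}) [ParacompactSpace X] (U : X → Set X)
    (hU : ∀ x, IsOpen (U x)) (hxU : ∀ x, x ∈ U x) :
    ∃ ρ : SmoothPartitionOfUnity X (𝓡 X.dim) X Set.univ, ρ.IsSubordinate U := by
  have : LocallyCompactSpace X :=
    Manifold.locallyCompact_of_finiteDimensional (𝓡 X.dim)
  -- The cover is refined through compact sets so that the shrunken closed sets `w x` are compact
  -- and finite sums of bump functions suffice; no σ-compactness is needed, as paracompactness gives
  -- the locally finite refinement.
  choose K hK hxK hKU using fun x => exists_compact_subset (hU x) (hxU x)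
  obtain ⟨v, hvo, hvc, hvf, hvK⟩ := precise_refinement (fun x => interior (K x))
    (fun x => isOpen_interior) (Set.eq_univ_of_forall fun x => Set.mem_iUnion.2 ⟨x, hxK x⟩)
  obtain ⟨w, hwc, hw, hwv⟩ := exists_iUnion_eq_closed_subset hvo hvf.point_finite hvc
  have hwK : ∀ x, IsCompact (w x) := fun x =>
    (hK x).of_isClosed_subset (hw x) (((hwv x).trans (hvK x)).trans interior_subset)
  choose f hf0 hfpos hfs using fun x => exists_smooth_pos_of_isCompact (hwK x) (hvo x) (hwv x)
  have hlf : LocallyFinite fun x => Function.support (f x) :=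
    hvf.subset fun x => (subset_tsupport _).trans (hfs x)
  let g : X → ℝ := fun y => ∑ᶠ x, f x y
  have hg : ContMDiff (𝓡 X.dim) 𝓘(ℝ, ℝ) ∞ g :=
    contMDiff_finsum (fun x => (f x).contMDiff) hlf
  have hfin : ∀ y, (Function.support fun x => f x y).Finite := fun y => hlf.point_finite y
  have hgpos : ∀ y, 0 < g y := by
    intro y
    obtain ⟨x, hx⟩ := Set.mem_iUnion.1 (hwc.symm ▸ Set.mem_univ y : y ∈ ⋃ x, w x)
    exact finsum_pos (fun x => hf0 x y) ⟨x, hfpos x y hx⟩ (hfin y)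
  have hdiv : ∀ x, ContMDiff (𝓡 X.dim) 𝓘(ℝ, ℝ) ∞ fun y => f x y / g y := fun x =>
    (f x).contMDiff.div₀ hg fun y => (hgpos y).ne'
  have hsupp : ∀ x, Function.support (fun y => f x y / g y) ⊆ Function.support (f x) := by
    intro x y hy hfy
    exact hy (by simp [hfy])
  have hsum : ∀ y, ∑ᶠ x, f x y / g y = 1 := by
    intro y
    simp only [div_eq_mul_inv]
    rw [← finsum_mul]
    exact mul_inv_cancel₀ (hgpos y).ne'
  refine ⟨⟨fun x => ⟨_, hdiv x⟩, hlf.subset hsupp, fun x y => div_nonneg (hf0 x y) (hgpos y).le,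
    fun y _ => hsum y, fun y => (hsum y).le⟩, fun x => ?_⟩
  exact (closure_mono (hsupp x)).trans (((hfs x).trans (hvK x)).trans
    (interior_subset.trans (hKU x)))

end Mfd

/-- A real-valued smooth function, restricted to an open subset and regarded as complex-valued. -/
noncomputable def Mfd.restrictReal {X : Mfd.{u}} (f : C^∞⟮𝓡 X.dim, X; 𝓘(ℝ, ℝ), ℝ⟯)
    (U : Opens X) : (X.ofOpens U).SmoothFn :=
  (⟨fun y : U => (f y : ℂ), Complex.ofRealCLM.contDiff.contMDiff.comp
    (f.contMDiff.comp contMDiff_subtype_val)⟩ : C^∞⟮𝓡 X.dim, U; 𝓘(ℝ, ℂ), ℂ⟯)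

lemma Mfd.point_comp {X Y : Mfd.{u}} (f : X ⟶ Y) (x : X) :
    Mfd.point x ≫ f = Mfd.point (Mfd.toMap f x) := rfl

/-! ### Gluing morphisms that are known on fibres -/

namespace SmoothTensorStack

open FibredTensorCategory Topology

variable {𝓕 : SmoothTensorStack.{u, v, w}}

/-- The vanishing axiom for `a - b`; it reduces the gluing conditions and the final identity to
single fibres. -/
lemma IsEuclidean.hom_ext (h𝓕 : 𝓕.IsEuclidean) {X : Mfd.{u}} {E F : 𝓕.obj X} {a b : E ⟶ F}
    (hab : ∀ x : X, (𝓕.pull (Mfd.point x)).map a = (𝓕.pull (Mfd.point x)).map b) : a = b := by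
  rw [← sub_eq_zero]
  refine h𝓕.vanishing _ fun x => ?_
  ext v
  simp [fibreMap, Functor.map_sub, hab x]

/-- A family of morphisms between the fibres that locally comes from morphisms of objects comes
from a global morphism. -/
lemma IsEuclidean.exists_hom_of_locally (h𝓕 : 𝓕.IsEuclidean) {X : Mfd.{u}} {E F : 𝓕.obj X}
    (T : ∀ x : X, (𝓕.pull (Mfd.point x)).obj E ⟶ (𝓕.pull (Mfd.point x)).obj F)
    (hT : ∀ x : X, ∃ U : Opens X, x ∈ U ∧
      ∃ a : (𝓕.pull (Mfd.ι U)).obj E ⟶ (𝓕.pull (Mfd.ι U)).obj F,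
        ∀ (y : X) (hy : y ∈ U),
          𝓕.pullHom (Mfd.point_ι U y hy) (Mfd.point_ι U y hy) a = T y) :
    ∃ b : E ⟶ F, ∀ x : X, (𝓕.pull (Mfd.point x)).map b = T x := by
  choose U hxU a ha using hT
  obtain ⟨b, hb⟩ := 𝓕.isStack.glue X X U
    (top_unique fun x _ => Opens.mem_iSup.2 ⟨x, hxU x⟩) E F a (by
      intro x x'
      -- Agreement on the overlap is tested on fibres, where both morphisms give `T y`.
      refine h𝓕.hom_ext fun y => map_eq_of_pullHom_eq (Mfd.point_ι _ y.1 y.2)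
        (Mfd.point_ι _ y.1 y.2) ?_
      rw [pullHom_pullHom (m := Mfd.point (X := X.ofOpens (U x)) ⟨y.1, y.2.1⟩) _ _ rfl
          (Mfd.point_ι _ y.1 y.2) (Mfd.point_ι _ y.1 y.2) (Mfd.point_ι _ y.1 y.2.1)
          (Mfd.point_ι _ y.1 y.2.1),
        pullHom_pullHom (m := Mfd.point (X := X.ofOpens (U x')) ⟨y.1, y.2.2⟩) _ _ rfl
          (Mfd.point_ι _ y.1 y.2) (Mfd.point_ι _ y.1 y.2) (Mfd.point_ι _ y.1 y.2.2)
          (Mfd.point_ι _ y.1 y.2.2), ha, ha])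
  refine ⟨b, fun x => ?_⟩
  rw [← ha x x (hxU x), ← hb x, pullHom_map]

lemma pullHom_point_homSMul {X Y₁ Y₂ : Mfd.{u}} (x : X) {f₁ : X ⟶ Y₁} {f₂ : X ⟶ Y₂}
    {h₁ : Mfd.pt ⟶ Y₁} {h₂ : Mfd.pt ⟶ Y₂} (e₁ : Mfd.point x ≫ f₁ = h₁)
    (e₂ : Mfd.point x ≫ f₂ = h₂) {E : 𝓕.obj Y₁} {F : 𝓕.obj Y₂} (c : X.SmoothFn)
    (a : (𝓕.pull f₁).obj E ⟶ (𝓕.pull f₂).obj F) :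
    𝓕.pullHom e₁ e₂ (homSMul c a) = c x • 𝓕.pullHom e₁ e₂ a := by
  simp [pullHom, map_point_homSMul]

/-- Local extensions of a morphism from a closed submanifold glue to a global extension. -/
lemma IsEuclidean.exists_extension_of_locally (h𝓕 : 𝓕.IsEuclidean) {X S : Mfd.{u}}
    [ParacompactSpace X] (i : S ⟶ X) {E F : 𝓕.obj X}
    (a' : (𝓕.pull i).obj E ⟶ (𝓕.pull i).obj F)
    (hloc : ∀ x : X, ∃ U : Opens X, x ∈ U ∧
      ∃ a : (𝓕.pull (Mfd.ι U)).obj E ⟶ (𝓕.pull (Mfd.ι U)).obj F,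
        ∀ (s : S) (hs : Mfd.toMap i s ∈ U),
          𝓕.pullHom (Mfd.point_ι U _ hs) (Mfd.point_ι U _ hs) a =
            𝓕.pullHom (Mfd.point_comp i s) (Mfd.point_comp i s) a') :
    ∃ a : E ⟶ F, (𝓕.pull i).map a = a' := by
  classical
  choose U hxU a ha using hloc
  obtain ⟨ρ, hρ⟩ := Mfd.exists_smoothPartitionOfUnity X (fun x => U x) (fun x => (U x).isOpen) hxU
  -- The default value 0 is consistent with the weight: `ρ x` vanishes outside `U x`.
  let t (x y : X) : (𝓕.pull (Mfd.point y)).obj E ⟶ (𝓕.pull (Mfd.point y)).obj F :=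
    if h : y ∈ U x then (ρ x y : ℂ) • 𝓕.pullHom (Mfd.point_ι (U x) y h) (Mfd.point_ι _ y h) (a x)
    else 0
  have ht0 : ∀ x y, ρ x y = 0 → t x y = 0 := by
    intro x y h
    simp [t, h]
  obtain ⟨b, hb⟩ := h𝓕.exists_hom_of_locally (fun y => ∑ᶠ x, t x y) (by
    intro x₀
    -- Near `x₀` only the finitely many indices whose closed support contains `x₀` contribute, and
    -- for these the neighbourhood can be taken inside `U x`, so the sum is a finite sum of
    -- restricted morphisms.
    have hN : ∀ᶠ y in 𝓝 x₀, ρ.finsupport y ⊆ ρ.fintsupport x₀ ∧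
        ∀ x ∈ ρ.fintsupport x₀, y ∈ U x :=
      (ρ.eventually_finsupport_subset x₀).and
        ((Filter.eventually_all_finset _).2 fun x hx =>
          (U x).isOpen.mem_nhds (hρ x ((ρ.mem_fintsupport_iff x₀ x).1 hx)))
    obtain ⟨N, hN, hNo, hx₀⟩ := eventually_nhds_iff.1 hN
    let N' : Opens X := ⟨N, hNo⟩
    have hNU : ∀ x ∈ ρ.fintsupport x₀, N' ≤ U x := fun x hx y hy => (hN y hy).2 x hx
    refine ⟨N', hx₀, ∑ x ∈ ρ.fintsupport x₀, if h : N' ≤ U x then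
      homSMul (Mfd.restrictReal (ρ x) N') (𝓕.pullHom (Mfd.incl_ι h) (Mfd.incl_ι h) (a x)) else 0,
      fun y hy => ?_⟩
    rw [pullHom_sum, finsum_eq_sum_of_support_subset (s := ρ.fintsupport x₀)]
    · refine Finset.sum_congr rfl fun x hx => ?_
      rw [dif_pos (hNU x hx)]
      refine (pullHom_point_homSMul (X := X.ofOpens N') ⟨y, hy⟩ _ _ _ _).trans ?_
      rw [pullHom_pullHom (m := Mfd.point (X := X.ofOpens (U x)) ⟨y, hNU x hx hy⟩) _ _ rfl _ _
        (Mfd.point_ι _ _ _) (Mfd.point_ι _ _ _)]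
      simp only [t, dif_pos (hNU x hx hy)]
      rfl
    · intro x hx
      refine (hN y hy).1 ?_
      rw [ρ.mem_finsupport]
      exact fun h => hx (ht0 x y h))
  refine ⟨b, h𝓕.hom_ext fun s => map_eq_of_pullHom_eq
    (Mfd.point_comp i s) (Mfd.point_comp i s) ?_⟩
  rw [pullHom_map, hb]
  -- True also when `i s` lies outside `U x`, both sides being zero; hence the sum over `x` is `a'`
  -- times the total weight 1.
  have ht : ∀ x, t x (Mfd.toMap i s) = (ρ x (Mfd.toMap i s) : ℂ) •
      𝓕.pullHom (Mfd.point_comp i s) (Mfd.point_comp i s) a' := by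
    intro x
    by_cases h : Mfd.toMap i s ∈ U x
    · simp only [t, dif_pos h, ha x s h]
    · have h0 : ρ x (Mfd.toMap i s) = 0 := by
        by_contra hne
        exact h (hρ x (subset_tsupport _ hne))
      rw [ht0 x _ h0, h0]
      simp
  have hsum := ρ.sum_finsupport _ (Set.mem_univ (Mfd.toMap i s))
  rw [finsum_eq_sum_of_support_subset (s := ρ.finsupport (Mfd.toMap i s)),
    Finset.sum_congr rfl fun x _ => ht x, ← Finset.sum_smul, ← Complex.ofReal_sum, hsum]
  · simp
  · intro x hx
    rw [Finset.mem_coe, ρ.mem_finsupport]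
    exact fun h => hx (ht0 x _ h)

lemma pullSec_point_ofFn_comp {Y X : Mfd.{u}} {y : Y} {f : Y ⟶ X} {h : Mfd.pt ⟶ X}
    (e : Mfd.point y ≫ f = h) {E : 𝓕.obj X} (c : Y.SmoothFn)
    (ζ : 𝟙_ (𝓕.obj Y) ⟶ (𝓕.pull f).obj E) :
    pullSec e (𝓕.ofFn c ≫ ζ) = c y • pullSec e ζ := by
  simp [pullSec, map_point_ofFn]

/-! ### Values of sections, and extension of sections from a submanifold -/

namespace Sec

variable {X : Mfd.{u}} {E F : 𝓕.obj X} {U V : Opens X}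

lemma eval_smul (c : (X.ofOpens U).SmoothFn) (ζ : Sec E U) (x : X) (hx : x ∈ U) :
    (smul c ζ).eval x hx = c (⟨x, hx⟩ : U) • ζ.eval x hx :=
  pullSec_point_ofFn_comp _ c ζ

lemma eval_res (ζ : Sec E U) (h : V ≤ U) (x : X) (hx : x ∈ V) :
    (ζ.res h).eval x hx = ζ.eval x (h hx) :=
  pullSec_pullSec (m := Mfd.point (X := X.ofOpens U) ⟨x, h hx⟩) _ rfl _ _ ζ

lemma eval_sum {ι : Type*} (s : Finset ι) (ζ : ι → Sec E U) (x : X) (hx : x ∈ U) :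
    eval (∑ k ∈ s, ζ k) x hx = ∑ k ∈ s, (ζ k).eval x hx :=
  pullSec_sum _ s ζ

lemma eval_comp_pullHom (ζ : Sec E U)
    (a : (𝓕.pull (Mfd.ι U)).obj E ⟶ (𝓕.pull (Mfd.ι U)).obj F) (x : X) (hx : x ∈ U) :
    ζ.eval x hx ≫ 𝓕.pullHom (Mfd.point_ι U x hx) (Mfd.point_ι U x hx) a =
      eval (E := F) (ζ ≫ a) x hx :=
  pullSec_comp_pullHom _ _ ζ a

end Sec

/-- The value at `f(x)`, as an element of `E_{f(x)}`, of a section of `f^* E` over a neighbourhood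
of `x`. -/
noncomputable def Sec.evalPull {X Y : Mfd.{u}} {f : X ⟶ Y} {E : 𝓕.obj Y} {U : Opens X}
    (ζ : Sec ((𝓕.pull f).obj E) U) (x : X) (hx : x ∈ U) : Fibre E (Mfd.toMap f x) :=
  ζ.eval x hx ≫ (𝓕.pullComp (Mfd.point_comp f x)).hom.app E

/-- Both sides are pull-backs of `η` along the same map from the one-point manifold to `V`; the
second constraint in `evalPull` cancels the inverse one in `compMap`. -/
lemma Sec.evalPull_compMap {X Y : Mfd.{u}} (f : X ⟶ Y) {E : 𝓕.obj Y} {V : Opens Y} (η : Sec E V)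
    {U : Opens X} (g : X.ofOpens U ⟶ Y.ofOpens V) (hg : g ≫ Mfd.ι V = Mfd.ι U ≫ f) (x : X)
    (hx : x ∈ U) (hfx : Mfd.toMap f x ∈ V) :
    (η.compMap f g hg).evalPull x hx = η.eval (Mfd.toMap f x) hfx := by
  have hgx : Mfd.point (X := X.ofOpens U) ⟨x, hx⟩ ≫ g =
      Mfd.point (X := Y.ofOpens V) ⟨Mfd.toMap f x, hfx⟩ := by
    have : Mfd.toMap g (⟨x, hx⟩ : U) = (⟨Mfd.toMap f x, hfx⟩ : V) := Subtype.ext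
      (congrArg (fun k : X.ofOpens U ⟶ Y => Mfd.toMap k (⟨x, hx⟩ : U)) hg)
    exact congrArg (Mfd.point (X := Y.ofOpens V)) this
  have hb : Mfd.point (X := X.ofOpens U) ⟨x, hx⟩ ≫ Mfd.ι U ≫ f = Mfd.point (Mfd.toMap f x) := rfl
  refine (pullSec_comp_pullComp_hom rfl _ _ hb _).trans ?_
  have : Sec.compMap f η g hg ≫ (𝓕.pullComp (rfl : Mfd.ι U ≫ f = Mfd.ι U ≫ f)).hom.app E =
      pullSec hg η := by
    simp only [Sec.compMap, Category.assoc]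
    erw [Iso.inv_hom_id_app]
    exact Category.comp_id _
  rw [this]
  exact pullSec_pullSec _ hgx _ _ _

/-- Sections of `i^* E` over an open subset of a closed submanifold extend, locally, to sections
of `E`. -/
lemma IsEuclidean.exists_sec_extension (h𝓕 : 𝓕.IsEuclidean) {X S : Mfd.{u}} {i : S ⟶ X}
    (hi : Mfd.IsClosedSubmanifold i) {E : 𝓕.obj X} {A : Opens S} (ζ' : Sec ((𝓕.pull i).obj E) A)
    (s₀ : S) (hs₀ : s₀ ∈ A) :
    ∃ W : Opens X, Mfd.toMap i s₀ ∈ W ∧ ∃ ζ : Sec E W, ∀ (s : S) (hs : Mfd.toMap i s ∈ W),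
      ∃ hA : s ∈ A, ζ.eval (Mfd.toMap i s) hs = ζ'.evalPull s hA := by
  -- Near `s₀` the section is `∑ c k • (η k ∘ i)`. The `η k` already live on `X`; only the
  -- coefficients must be extended, by `c k ∘ r`.
  obtain ⟨A', hA', V, g, hg, hs₀', n, c, η, hη⟩ := h𝓕.pull_surjective i E A ζ' s₀ hs₀
  have hgV : ∀ (s : S), s ∈ A' → Mfd.toMap i s ∈ V := by
    intro s hs
    have : (Mfd.toMap g (⟨s, hs⟩ : A')).1 = Mfd.toMap i s :=
      congrArg (fun k : S.ofOpens A' ⟶ X => Mfd.toMap k (⟨s, hs⟩ : A')) hg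
    rw [← this]
    exact (Mfd.toMap g (⟨s, hs⟩ : A')).2
  obtain ⟨W, hWV, r, hW, hr⟩ := hi.exists_retraction s₀ A' hs₀' V (hgV s₀ hs₀')
  refine ⟨W, hW, ∑ k, Sec.smul ((c k).comp (Mfd.toMap r)) ((η k).res hWV), fun s hs => ?_⟩
  have hsA' : s ∈ A' := by
    have := (Mfd.toMap r (⟨Mfd.toMap i s, hs⟩ : W)).2
    rwa [show (Mfd.toMap r (⟨Mfd.toMap i s, hs⟩ : W)).1 = s from hr s hs] at this
  have hrs : Mfd.toMap r (⟨Mfd.toMap i s, hs⟩ : W) = (⟨s, hsA'⟩ : A') := Subtype.ext (hr s hs)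
  refine ⟨hA' hsA', ?_⟩
  have h1 := congrArg (fun ξ : Sec ((𝓕.pull i).obj E) A' => ξ.evalPull s hsA') hη
  have h2 : (ζ'.res hA').evalPull s hsA' = ζ'.evalPull s (hA' hsA') := by
    simp only [Sec.evalPull, Sec.eval_res]
  rw [← h2, h1, Sec.eval_sum]
  simp only [Sec.evalPull, Sec.eval_sum, Preadditive.sum_comp]
  refine Finset.sum_congr rfl fun k _ => ?_
  rw [Sec.eval_smul, Sec.eval_smul, Sec.eval_res, Linear.smul_comp,
    ← Sec.evalPull_compMap i (η k) g hg s hsA' (hgV s hsA')]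
  congr 1
  exact congrArg (c k) hrs

/-- The index set is finite, so the separate neighbourhoods can be intersected with each other and
with `V`. -/
lemma IsEuclidean.exists_sec_family_extension (h𝓕 : 𝓕.IsEuclidean) {X S : Mfd.{u}} {i : S ⟶ X}
    (hi : Mfd.IsClosedSubmanifold i) {ι : Type*} [Finite ι] {E : 𝓕.obj X} {A : Opens S}
    (ζ' : ι → Sec ((𝓕.pull i).obj E) A) (s₀ : S) (hs₀ : s₀ ∈ A) (V : Opens X)
    (hV : Mfd.toMap i s₀ ∈ V) :
    ∃ W ≤ V, Mfd.toMap i s₀ ∈ W ∧ ∃ ζ : ι → Sec E W, ∀ k (s : S) (hs : Mfd.toMap i s ∈ W)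
      (hA : s ∈ A), (ζ k).eval (Mfd.toMap i s) hs = (ζ' k).evalPull s hA := by
  choose W hW ζ hζ using fun k => h𝓕.exists_sec_extension hi (ζ' k) s₀ hs₀
  obtain ⟨N, hN, hNo, hsN⟩ := mem_nhds_iff.1 (Filter.inter_mem (V.isOpen.mem_nhds hV)
    (Filter.iInter_mem.2 fun k => (W k).isOpen.mem_nhds (hW k)))
  have hNW : ∀ k, (⟨N, hNo⟩ : Opens X) ≤ W k := fun k x hx => Set.mem_iInter.1 (hN hx).2 k
  refine ⟨⟨N, hNo⟩, fun x hx => (hN hx).1, hsN, fun k => (ζ k).res (hNW k), fun k s hs hA => ?_⟩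
  obtain ⟨_, h⟩ := hζ k s (hNW k hs)
  rw [Sec.eval_res, h]

/-! ### Metrics and Gram matrices -/

lemma scalar_add (a b : Star (𝟙_ (𝓕.obj Mfd.pt.{u}))) : scalar (a + b) = scalar a + scalar b := by
  have : 𝓕.fn Mfd.pt (a + b) = 𝓕.fn Mfd.pt a + 𝓕.fn Mfd.pt b := map_add (𝓕.fn Mfd.pt) a b
  simp only [scalar, this]
  rfl

lemma scalar_smul (c : ℂ) (a : Star (𝟙_ (𝓕.obj Mfd.pt.{u}))) : scalar (c • a) = c * scalar a := by
  conv_lhs => rw [← scalar_smul_eq a, smul_smul, scalar_smul_id]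

lemma fibreForm_add_left {X : Mfd.{u}} {E : 𝓕.obj X}
    (φ : E ⊗ (conj (𝓕.obj X)).obj E ⟶ 𝟙_ (𝓕.obj X)) (x : X) (v v' w : Fibre E x) :
    fibreForm φ x (v + v') w = fibreForm φ x v w + fibreForm φ x v' w := by
  simp only [fibreForm, ← scalar_add]
  simp [MonoidalPreadditive.add_tensor]

lemma fibreForm_smul_left {X : Mfd.{u}} {E : 𝓕.obj X}
    (φ : E ⊗ (conj (𝓕.obj X)).obj E ⟶ 𝟙_ (𝓕.obj X)) (x : X) (c : ℂ) (v w : Fibre E x) :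
    fibreForm φ x (c • v) w = c * fibreForm φ x v w := by
  simp only [fibreForm, ← scalar_smul]
  simp [MonoidalCategory.tensorHom_def]

/-- The form on a fibre, as a linear map in the first variable. -/
@[simps]
noncomputable def fibreFormLeft {X : Mfd.{u}} {E : 𝓕.obj X}
    (φ : E ⊗ (conj (𝓕.obj X)).obj E ⟶ 𝟙_ (𝓕.obj X)) (x : X) (w : Fibre E x) :
    Fibre E x →ₗ[ℂ] ℂ where
  toFun v := fibreForm φ x v w
  map_add' v v' := fibreForm_add_left φ x v v' w
  map_smul' c v := fibreForm_smul_left φ x c v w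

/-- The Gram matrix of linearly independent vectors of a fibre is nondegenerate. -/
lemma IsMetric.det_ne_zero {X : Mfd.{u}} {E : 𝓕.obj X}
    {φ : E ⊗ (conj (𝓕.obj X)).obj E ⟶ 𝟙_ (𝓕.obj X)} (hφ : IsMetric φ) {x : X} {ι : Type*}
    [Fintype ι] [DecidableEq ι] {v : ι → Fibre E x} (hv : LinearIndependent ℂ v) :
    (Matrix.of fun k l => fibreForm φ x (v k) (v l)).det ≠ 0 := by
  intro h
  -- A singular Gram matrix yields a nonzero combination `w` of the `v k` that is orthogonal to all
  -- of them, hence to itself.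
  obtain ⟨c, hc, hcM⟩ := Matrix.exists_vecMul_eq_zero_iff.2 h
  set w : Fibre E x := ∑ k, c k • v k with hw
  have hw0 : w ≠ 0 := by
    intro hw0
    exact hc (funext (Fintype.linearIndependent_iff.1 hv c hw0))
  have h1 : ∀ l, fibreForm φ x w (v l) = 0 := by
    intro l
    have := congrFun hcM l
    simp only [Matrix.vecMul, dotProduct, Matrix.of_apply, Pi.zero_apply] at this
    rw [← fibreFormLeft_apply, hw, map_sum]
    simpa using this
  -- Only the first variable is expanded; Hermitian symmetry takes the place of antilinearity in the
  -- second.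
  have h2 : fibreForm φ x w w = 0 := by
    conv_lhs => rw [← fibreFormLeft_apply]; arg 2; rw [hw]
    rw [map_sum]
    refine Finset.sum_eq_zero fun l _ => ?_
    rw [map_smul, fibreFormLeft_apply, (hφ x).1 w (v l), h1]
    simp
  have := (hφ x).2 w hw0
  rw [h2] at this
  exact lt_irrefl _ this

/-- The value at a point of a global section. -/
noncomputable def fibreVal {X : Mfd.{u}} {E : 𝓕.obj X} (ζ : 𝟙_ (𝓕.obj X) ⟶ E) (x : X) :
    Fibre E x :=
  Functor.LaxMonoidal.ε (𝓕.pull (Mfd.point x)) ≫ (𝓕.pull (Mfd.point x)).map ζ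

/-- The section of `E^*` conjugate to a section of `E`. -/
noncomputable def conjSec {C : Type*} [Category C] [Preadditive C] [Linear ℂ C]
    [MonoidalCategory C] [SymmetricCategory C] [AntiInvolution C] {E : C} (ζ : 𝟙_ C ⟶ E) :
    𝟙_ C ⟶ (conj C).obj E :=
  Functor.LaxMonoidal.ε (conj C) ≫ (conj C).map ζ

/-- Naturality of `conjIso` and its compatibility with the unit constraints. -/
lemma fibreConj_fibreVal {X : Mfd.{u}} {E : 𝓕.obj X} (ζ : 𝟙_ (𝓕.obj X) ⟶ E) (x : X) :
    fibreConj (fibreVal ζ x) = fibreVal (conjSec ζ) x := by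
  have h1 := (StarFunctor.monoidal (F := 𝓕.pull (Mfd.point x))).unit
  have h2 := (StarFunctor.conjIso (F := 𝓕.pull (Mfd.point x))).hom.naturality ζ
  simp only [Functor.comp_map] at h2
  simp only [Functor.LaxMonoidal.comp_ε, Category.assoc] at h1
  simp only [fibreConj, fibreVal, conjSec, Functor.map_comp, Category.assoc]
  rw [h2, reassoc_of% h1]

/-- The functional on `E` that a form and a section of `E` define. -/
noncomputable def formFunctional {X : Mfd.{u}} {E : 𝓕.obj X}
    (φ : E ⊗ (conj (𝓕.obj X)).obj E ⟶ 𝟙_ (𝓕.obj X)) (ξ : 𝟙_ (𝓕.obj X) ⟶ E) : E ⟶ 𝟙_ (𝓕.obj X) :=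
  (ρ_ E).inv ≫ (E ◁ conjSec ξ) ≫ φ

lemma fn_apply {X : Mfd.{u}} (a : 𝟙_ (𝓕.obj X) ⟶ 𝟙_ (𝓕.obj X)) (x : X) :
    𝓕.fn X a x = scalar (fibreVal a x ≫ Functor.OplaxMonoidal.η (𝓕.pull (Mfd.point x))) := by
  rw [scalar, fibreVal, Category.assoc, 𝓕.fn_pull]
  rfl

/-- Pull-back to a point is a tensor* functor, so it carries the global pairing to the fibrewise
one. Hence Gram matrices of sections have smooth entries. -/
lemma fn_comp_formFunctional {X : Mfd.{u}} {E : 𝓕.obj X}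
    (φ : E ⊗ (conj (𝓕.obj X)).obj E ⟶ 𝟙_ (𝓕.obj X)) (ζ ξ : 𝟙_ (𝓕.obj X) ⟶ E) (x : X) :
    𝓕.fn X (ζ ≫ formFunctional φ ξ) x = fibreForm φ x (fibreVal ζ x) (fibreVal ξ x) := by
  have h : ζ ≫ formFunctional φ ξ = (λ_ _).inv ≫ (ζ ⊗ₘ conjSec ξ) ≫ φ := by
    simp [formFunctional, MonoidalCategory.tensorHom_def, unitors_inv_equal]
  rw [fn_apply, fibreForm, fibreConj_fibreVal, h]
  congr 1
  simp only [fibreVal, Functor.map_comp, Category.assoc]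
  have h1 : ∀ {Y : 𝓕.obj Mfd.pt} (k : (𝓕.pull (Mfd.point x)).obj (𝟙_ (𝓕.obj X) ⊗ 𝟙_ (𝓕.obj X)) ⟶ Y),
    Functor.LaxMonoidal.ε (𝓕.pull (Mfd.point x)) ≫ (𝓕.pull (Mfd.point x)).map (λ_ _).inv ≫ k =
      (λ_ _).inv ≫ (Functor.LaxMonoidal.ε (𝓕.pull (Mfd.point x)) ⊗ₘ
        Functor.LaxMonoidal.ε (𝓕.pull (Mfd.point x))) ≫ Functor.LaxMonoidal.μ _ _ _ ≫ k := by
    intro Y k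
    rw [← Functor.LaxMonoidal.left_unitality_inv]
    simp [MonoidalCategory.tensorHom_def']
  rw [h1, ← MonoidalCategory.tensorHom_comp_tensorHom_assoc,
    Functor.LaxMonoidal.μ_natural_assoc]

end SmoothTensorStack

/-- A smooth map with values in an open subset, as a smooth map to this subset. -/
noncomputable def Mfd.codRestrict {Y X : Mfd.{u}} (f : Y ⟶ X) (U : Opens X) (hf : ∀ y, Mfd.toMap f y ∈ U) :
    Y ⟶ X.ofOpens U :=
  (⟨fun y => ⟨Mfd.toMap f y, hf y⟩, (ContMDiff.subtypeVal_comp_iff U _).1 (Mfd.toMap f).contMDiff⟩ :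
    C^∞⟮𝓡 Y.dim, Y; 𝓡 X.dim, U⟯)

lemma Mfd.exists_smoothFn_inv {X : Mfd.{u}} (c : X.SmoothFn) (hc : ∀ x, c x ≠ 0) :
    ∃ d : X.SmoothFn, ∀ x, d x = (c x)⁻¹ :=
  ⟨⟨fun x => (c x)⁻¹, fun x => (contDiffAt_inv ℝ (hc x)).contMDiffAt.comp x (c.contMDiff x)⟩,
    fun _ => rfl⟩

/-! ### Local functionals and Cramer's rule -/

namespace SmoothTensorStack

open FibredTensorCategory Topology

variable {𝓕 : SmoothTensorStack.{u, v, w}}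

/-- The pull-back of a functional. -/
noncomputable def pullFunctional {Z Y X : Mfd.{u}} {g : Z ⟶ Y} {f : Y ⟶ X} {h : Z ⟶ X}
    (e : g ≫ f = h) {E : 𝓕.obj X} (q : (𝓕.pull f).obj E ⟶ 𝟙_ (𝓕.obj Y)) :
    (𝓕.pull h).obj E ⟶ 𝟙_ (𝓕.obj Z) :=
  (𝓕.pullComp e).inv.app E ≫ (𝓕.pull g).map q ≫ Functor.OplaxMonoidal.η (𝓕.pull g)

lemma fn_pullSec_comp_pullFunctional {Z Y X : Mfd.{u}} {g : Z ⟶ Y} {f : Y ⟶ X} {h : Z ⟶ X}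
    (e : g ≫ f = h) {E : 𝓕.obj X} (ζ : 𝟙_ (𝓕.obj Y) ⟶ (𝓕.pull f).obj E)
    (q : (𝓕.pull f).obj E ⟶ 𝟙_ (𝓕.obj Y)) :
    𝓕.fn Z (pullSec e ζ ≫ pullFunctional e q) = (𝓕.fn Y (ζ ≫ q)).comp (Mfd.toMap g) := by
  rw [← 𝓕.fn_pull]
  simp [pullSec, pullFunctional]

/-- Sections that are linearly independent at a point are separated, near this point, by
functionals. -/
lemma IsEuclidean.exists_functionals (h𝓕 : 𝓕.IsEuclidean) {X : Mfd.{u}} {E : 𝓕.obj X}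
    {W : Opens X} {x₀ : X} (hx₀ : x₀ ∈ W) {ι : Type*} [Fintype ι] [DecidableEq ι]
    (ζ : ι → Sec E W) (hζ : LinearIndependent ℂ fun k => (ζ k).eval x₀ hx₀) :
    ∃ (U : Opens X) (hUW : U ≤ W) (hxU : x₀ ∈ U)
      (q : ι → ((𝓕.pull (Mfd.ι U)).obj E ⟶ 𝟙_ (𝓕.obj (X.ofOpens U)))),
      (Matrix.of fun k l => 𝓕.fn (X.ofOpens U) ((ζ k).res hUW ≫ q l) (⟨x₀, hxU⟩ : U)).det ≠ 0 := by
  let x₁ : X.ofOpens W := (⟨x₀, hx₀⟩ : W)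
  obtain ⟨U₁, hxU₁, φ, hφ⟩ := h𝓕.local_metrics ((𝓕.pull (Mfd.ι W)).obj E) x₁
  let z₀ : (X.ofOpens W).ofOpens U₁ := (⟨x₁, hxU₁⟩ : U₁)
  let j : (X.ofOpens W).ofOpens U₁ ⟶ X := Mfd.ι U₁ ≫ Mfd.ι W
  have ej : Mfd.ι U₁ ≫ Mfd.ι W = j := rfl
  -- The metric lives over `U₁`, an open subset of the manifold `W`; `U` is the same set as an open
  -- subset of `X`, and `k` identifies the two.
  let U : Opens X := ⟨Subtype.val '' {y : W | y ∈ U₁}, W.isOpen.isOpenMap_subtype_val _ U₁.isOpen⟩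
  have hUW : U ≤ W := by
    rintro _ ⟨y, -, rfl⟩
    exact y.2
  have hUU₁ : ∀ (y : X) (hy : y ∈ U), (⟨y, hUW hy⟩ : W) ∈ U₁ := by
    rintro _ ⟨y, hy, rfl⟩
    exact hy
  let k : X.ofOpens U ⟶ (X.ofOpens W).ofOpens U₁ :=
    Mfd.codRestrict (Mfd.incl hUW) U₁ fun y => hUU₁ y.1 y.2
  have ek : k ≫ j = Mfd.ι U := rfl
  have hxU : x₀ ∈ U := ⟨⟨x₀, hx₀⟩, hxU₁, rfl⟩
  -- the sections over the domain of the metric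
  let ξ (l : ι) : 𝟙_ (𝓕.obj ((X.ofOpens W).ofOpens U₁)) ⟶
      (𝓕.pull (Mfd.ι U₁)).obj ((𝓕.pull (Mfd.ι W)).obj E) :=
    Functor.LaxMonoidal.ε (𝓕.pull (Mfd.ι U₁)) ≫ (𝓕.pull (Mfd.ι U₁)).map (ζ l)
  have hξ : ∀ l, pullSec ej (ζ l) = ξ l ≫ (𝓕.pullComp ej).hom.app E := fun l => by
    simp [pullSec, ξ]
  have hind : LinearIndependent ℂ fun l => fibreVal (ξ l) z₀ := by
    have ez : Mfd.point z₀ ≫ j = Mfd.point x₀ := rfl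
    refine LinearIndependent.of_comp (Linear.rightComp ℂ _
      ((𝓕.pull (Mfd.point z₀)).map ((𝓕.pullComp ej).hom.app E) ≫ (𝓕.pullComp ez).hom.app E)) ?_
    convert hζ with l
    have h1 : (ζ l).eval x₀ hx₀ = pullSec ez (pullSec ej (ζ l)) :=
      (pullSec_pullSec ej (k := Mfd.point z₀) (m := Mfd.point x₁) rfl ez _ (ζ l)).symm
    rw [h1, hξ l]
    simp [pullSec, fibreVal]
  refine ⟨U, hUW, hxU, fun l => pullFunctional ek
    ((𝓕.pullComp ej).inv.app E ≫ formFunctional φ (ξ l)), ?_⟩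
  -- Transported to `U`, the functional number `m` is still the pairing with `ζ m`, so the matrix at
  -- `x₀` is the Gram matrix.
  have h2 : ∀ l m, 𝓕.fn (X.ofOpens U) ((ζ l).res hUW ≫ pullFunctional ek
      ((𝓕.pullComp ej).inv.app E ≫ formFunctional φ (ξ m))) (⟨x₀, hxU⟩ : U) =
      fibreForm φ z₀ (fibreVal (ξ l) z₀) (fibreVal (ξ m) z₀) := by
    intro l m
    have h3 : (ζ l).res hUW = pullSec ek (pullSec ej (ζ l)) :=
      (pullSec_pullSec ej (k := k) (m := Mfd.incl hUW) rfl ek _ (ζ l)).symm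
    have h4 : pullSec ej (ζ l) ≫ (𝓕.pullComp ej).inv.app E ≫ formFunctional φ (ξ m) =
        ξ l ≫ formFunctional φ (ξ m) := by
      simp [hξ]
    rw [← fn_comp_formFunctional, h3, ← h4]
    exact DFunLike.congr_fun (fn_pullSec_comp_pullFunctional ek _ _) _
  have h5 := hφ.det_ne_zero hind
  simp only [← h2] at h5
  exact h5

/-- Cramer's rule `G * adjugate G = det G`. The adjugate postpones the division until the domain is
shrunk to where the determinant has no zeros. -/
lemma comp_sum_adjugate {X : Mfd.{u}} {E F : 𝓕.obj X} {ι : Type*} [Fintype ι] [DecidableEq ι]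
    (ζ : ι → (𝟙_ (𝓕.obj X) ⟶ E)) (q : ι → (E ⟶ 𝟙_ (𝓕.obj X))) (θ : ι → (𝟙_ (𝓕.obj X) ⟶ F))
    {G : Matrix ι ι X.SmoothFn} (hG : ∀ k l, G k l = 𝓕.fn X (ζ k ≫ q l)) (j : ι) :
    ζ j ≫ (∑ k, ∑ l, q l ≫ 𝓕.ofFn (G.adjugate l k) ≫ θ k) = 𝓕.ofFn G.det ≫ θ j := by
  have h1 : ∀ k, ζ j ≫ (∑ l, q l ≫ 𝓕.ofFn (G.adjugate l k) ≫ θ k) =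
      𝓕.ofFn ((G * G.adjugate) j k) ≫ θ k := by
    intro k
    rw [Matrix.mul_apply, ofFn_sum, Preadditive.comp_sum, Preadditive.sum_comp]
    refine Finset.sum_congr rfl fun l _ => ?_
    rw [ofFn_mul, hG, ofFn_fn]
    simp only [Category.assoc]
  rw [Preadditive.comp_sum, Finset.sum_congr rfl fun k _ => h1 k, Matrix.mul_adjugate,
    Finset.sum_eq_single j]
  · simp
  · intro k _ hk
    simp [Matrix.smul_apply, Matrix.one_apply_ne hk.symm, ofFn_zero]
  · simp

/-- Sections that are linearly independent at a point can be mapped, near this point, to given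
sections by a morphism. -/
lemma IsEuclidean.exists_hom_of_linearIndependent (h𝓕 : 𝓕.IsEuclidean) {X : Mfd.{u}}
    {E F : 𝓕.obj X} {W : Opens X} {x₀ : X} (hx₀ : x₀ ∈ W) {ι : Type*} [Fintype ι] [DecidableEq ι]
    (ζ : ι → Sec E W) (hζ : LinearIndependent ℂ fun k => (ζ k).eval x₀ hx₀) (θ : ι → Sec F W) :
    ∃ (N : Opens X) (hNW : N ≤ W) (_ : x₀ ∈ N)
      (a : (𝓕.pull (Mfd.ι N)).obj E ⟶ (𝓕.pull (Mfd.ι N)).obj F),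
      ∀ (y : X) (hy : y ∈ N) (k : ι),
        (ζ k).eval y (hNW hy) ≫ 𝓕.pullHom (Mfd.point_ι N y hy) (Mfd.point_ι N y hy) a =
          (θ k).eval y (hNW hy) := by
  obtain ⟨U, hUW, hxU, q, hq⟩ := h𝓕.exists_functionals hx₀ ζ hζ
  let G : Matrix ι ι (X.ofOpens U).SmoothFn :=
    Matrix.of fun k l => 𝓕.fn (X.ofOpens U) ((ζ k).res hUW ≫ q l)
  let D : (X.ofOpens U).SmoothFn := G.det
  have hD : D (⟨x₀, hxU⟩ : U) ≠ 0 := by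
    convert hq
    -- Evaluation at `x₀` is a ring homomorphism, so it commutes with the determinant.
    exact RingHom.map_det (ContMDiffMap.evalRingHom (I := 𝓡 X.dim) (I' := 𝓘(ℝ, ℂ)) (n := ∞)
      (⟨x₀, hxU⟩ : U)) G
  let a₀ : (𝓕.pull (Mfd.ι U)).obj E ⟶ (𝓕.pull (Mfd.ι U)).obj F :=
    ∑ k, ∑ l, q l ≫ 𝓕.ofFn (G.adjugate l k) ≫ (θ k).res hUW
  have ha₀ : ∀ j, (ζ j).res hUW ≫ a₀ = 𝓕.ofFn D ≫ (θ j).res hUW :=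
    comp_sum_adjugate _ q _ (fun _ _ => rfl)
  let N : Opens X := ⟨Subtype.val '' {y : U | D y ≠ 0}, U.isOpen.isOpenMap_subtype_val _
    (isOpen_ne_fun D.contMDiff.continuous continuous_const)⟩
  have hNU : N ≤ U := by
    rintro _ ⟨y, -, rfl⟩
    exact y.2
  have hND : ∀ (y : X) (hy : y ∈ N), D (⟨y, hNU hy⟩ : U) ≠ 0 := by
    rintro _ ⟨y, hy, rfl⟩
    exact hy
  obtain ⟨h, hh⟩ := Mfd.exists_smoothFn_inv (D.comp (Mfd.toMap (Mfd.incl hNU)))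
    fun y => hND y.1 y.2
  refine ⟨N, hNU.trans hUW, ⟨_, hD, rfl⟩,
    homSMul h (𝓕.pullHom (Mfd.incl_ι hNU) (Mfd.incl_ι hNU) a₀), fun y hy k => ?_⟩
  have h1 : 𝓕.pullHom (Mfd.point_ι N y hy) (Mfd.point_ι N y hy)
      (homSMul h (𝓕.pullHom (Mfd.incl_ι hNU) (Mfd.incl_ι hNU) a₀)) =
      (D (⟨y, hNU hy⟩ : U))⁻¹ • 𝓕.pullHom (Mfd.point_ι U y (hNU hy)) (Mfd.point_ι U y (hNU hy)) a₀ := by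
    refine (pullHom_point_homSMul (X := X.ofOpens N) ⟨y, hy⟩ _ _ _ _).trans ?_
    rw [pullHom_pullHom (m := Mfd.point (X := X.ofOpens U) ⟨y, hNU hy⟩) _ _ rfl _ _
        (Mfd.point_ι _ _ _) (Mfd.point_ι _ _ _)]
    exact congrArg (· • _) (hh (⟨y, hy⟩ : N))
  rw [h1, Linear.comp_smul, ← Sec.eval_res (ζ k) hUW y (hNU hy), Sec.eval_comp_pullHom, ha₀]
  have h2 : Sec.eval (E := F) (𝓕.ofFn D ≫ (θ k).res hUW) y (hNU hy) =
      D (⟨y, hNU hy⟩ : U) • ((θ k).res hUW).eval y (hNU hy) := Sec.eval_smul D _ _ _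
  rw [h2, smul_smul, inv_mul_cancel₀ (hND y hy), one_smul, Sec.eval_res]

/-! ### Frames of locally free objects and the local extension -/

section Frame

variable {X : Mfd.{u}} {E : 𝓕.obj X} {U : Opens X} {d : ℕ}
  (e : (𝓕.pull (Mfd.ι U)).obj E ≅ ⨁ fun _ : Fin d => 𝟙_ (𝓕.obj (X.ofOpens U)))

/-- The sections that a local trivialization defines. -/
noncomputable def frameSec (k : Fin d) : Sec E U :=
  Limits.biproduct.ι (fun _ : Fin d => 𝟙_ (𝓕.obj (X.ofOpens U))) k ≫ e.inv

/-- The coordinate projections of the trivialization, pulled back to the point, are a dual family.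
-/
lemma linearIndependent_frameSec (x : X) (hx : x ∈ U) :
    LinearIndependent ℂ fun k => (frameSec e k).eval x hx := by
  rw [Fintype.linearIndependent_iff]
  intro c hc l
  let q := pullFunctional (Mfd.point_ι U x hx) (e.hom ≫ Limits.biproduct.π _ l)
  have h1 : ∀ k, (frameSec e k).eval x hx ≫ q =
      if k = l then 𝟙 (𝟙_ (𝓕.obj Mfd.pt.{u})) else 0 := by
    intro k
    have h2 : frameSec e k ≫ e.hom ≫ Limits.biproduct.π _ l =
        if k = l then 𝟙 (𝟙_ (𝓕.obj (X.ofOpens U))) else 0 := by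
      simp only [frameSec, Category.assoc, Iso.inv_hom_id_assoc, Limits.biproduct.ι_π]
      split_ifs <;> rfl
    have h3 : (frameSec e k).eval x hx ≫ q = Functor.LaxMonoidal.ε _ ≫
        (𝓕.pull (Mfd.point (X := X.ofOpens U) ⟨x, hx⟩)).map
          (frameSec e k ≫ e.hom ≫ Limits.biproduct.π _ l) ≫ Functor.OplaxMonoidal.η _ := by
      simp [q, Sec.eval, pullSec, pullFunctional]
    rw [h3, h2]
    split_ifs <;> simp
  have h4 : (∑ k, c k • (frameSec e k).eval x hx) ≫ q = c l • 𝟙 (𝟙_ (𝓕.obj Mfd.pt.{u})) := by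
    simp [Preadditive.sum_comp, h1]
  rw [hc, Limits.zero_comp] at h4
  rw [← scalar_smul_id (𝓕 := 𝓕) (c l), ← h4, ← zero_smul ℂ (𝟙 (𝟙_ (𝓕.obj Mfd.pt.{u}))),
    scalar_smul_id]

/-- An additive functor preserves the decomposition of the identity of a biproduct, and the unit
constraint `ε` is invertible, so testing on frame values is testing on each summand. -/
lemma hom_ext_frameSec (x : X) (hx : x ∈ U) {V : 𝓕.obj Mfd.pt.{u}}
    {a b : (𝓕.pull (Mfd.point x)).obj E ⟶ V}
    (hab : ∀ k, (frameSec e k).eval x hx ≫ a = (frameSec e k).eval x hx ≫ b) : a = b := by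
  let K := 𝓕.pull (Mfd.point (X := X.ofOpens U) ⟨x, hx⟩)
  let f : K.obj (⨁ fun _ : Fin d => 𝟙_ (𝓕.obj (X.ofOpens U))) ≅ (𝓕.pull (Mfd.point x)).obj E :=
    K.mapIso e.symm ≪≫ (𝓕.pullComp (Mfd.point_ι U x hx)).app E
  have h1 : ∀ k, (frameSec e k).eval x hx =
      Functor.LaxMonoidal.ε K ≫
        K.map (Limits.biproduct.ι (fun _ : Fin d => 𝟙_ (𝓕.obj (X.ofOpens U))) k) ≫ f.hom := by
    intro k
    simp [f, K, Sec.eval, pullSec, frameSec]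
  have h2 : 𝟙 (K.obj (⨁ fun _ : Fin d => 𝟙_ (𝓕.obj (X.ofOpens U)))) =
      ∑ k, K.map (Limits.biproduct.π _ k) ≫ K.map (Limits.biproduct.ι _ k) := by
    rw [← CategoryTheory.Functor.map_id, ← Limits.biproduct.total, Functor.map_sum]
    simp only [Functor.map_comp]
  rw [← cancel_epi f.hom, ← Category.id_comp (f.hom ≫ a), ← Category.id_comp (f.hom ≫ b), h2,
    Preadditive.sum_comp, Preadditive.sum_comp]
  refine Finset.sum_congr rfl fun k _ => ?_
  have h3 := hab k
  rw [h1] at h3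
  simp only [Category.assoc] at h3 ⊢
  rw [(cancel_epi _).1 h3]

end Frame

lemma Sec.eval_map {X : Mfd.{u}} {E F : 𝓕.obj X} (a : E ⟶ F) {U : Opens X} (ζ : Sec E U) (x : X)
    (hx : x ∈ U) : (ζ.map a).eval x hx = ζ.eval x hx ≫ (𝓕.pull (Mfd.point x)).map a := by
  rw [← pullHom_map (Mfd.point_ι U x hx) a, Sec.eval_comp_pullHom]
  rfl

/-- Near a point of a closed submanifold, morphisms from an object that is locally free over the
submanifold extend. -/
lemma IsEuclidean.exists_local_extension (h𝓕 : 𝓕.IsEuclidean) {X S : Mfd.{u}} {i : S ⟶ X}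
    (hi : Mfd.IsClosedSubmanifold i) {E F : 𝓕.obj X} (hE : IsLocallyFree ((𝓕.pull i).obj E))
    (a' : (𝓕.pull i).obj E ⟶ (𝓕.pull i).obj F) (s₀ : S) :
    ∃ U : Opens X, Mfd.toMap i s₀ ∈ U ∧
      ∃ a : (𝓕.pull (Mfd.ι U)).obj E ⟶ (𝓕.pull (Mfd.ι U)).obj F,
        ∀ (s : S) (hs : Mfd.toMap i s ∈ U),
          𝓕.pullHom (Mfd.point_ι U _ hs) (Mfd.point_ι U _ hs) a =
            𝓕.pullHom (Mfd.point_comp i s) (Mfd.point_comp i s) a' := by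
  obtain ⟨A, hA, d, ⟨e⟩⟩ := hE s₀
  obtain ⟨O, hO, hOA⟩ := hi.1.isEmbedding.isOpen_iff.1 A.isOpen
  have hOA' : ∀ s, Mfd.toMap i s ∈ O → s ∈ A := fun s hs => hOA.subset hs
  have hs₀O : Mfd.toMap i s₀ ∈ O := hOA.symm.subset hA
  obtain ⟨W₁, hW₁O, hs₀W₁, ζ₁, hζ₁⟩ :=
    -- Staying inside `O` ensures that every point of `S` met later lies in `A`, where the frame is
    -- defined.
    h𝓕.exists_sec_family_extension hi (frameSec e) s₀ hA ⟨O, hO⟩ hs₀O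
  obtain ⟨W, hWW₁, hs₀W, θ, hθ⟩ :=
    h𝓕.exists_sec_family_extension hi (fun k => (frameSec e k).map a') s₀ hA W₁ hs₀W₁
  have hζ : ∀ k (s : S) (hs : Mfd.toMap i s ∈ W) (hA : s ∈ A),
      ((ζ₁ k).res hWW₁).eval (Mfd.toMap i s) hs = (frameSec e k).evalPull s hA := by
    intro k s hs hA
    rw [Sec.eval_res, hζ₁ k s (hWW₁ hs) hA]
  have hind : LinearIndependent ℂ fun k => ((ζ₁ k).res hWW₁).eval (Mfd.toMap i s₀) hs₀W := by
    -- The canonical map from `E_{i(s₀)}` to `(i^* E)_{s₀}` sends the extended values to the frame,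
    -- so they inherit its independence.
    have h0 : (fun k => (frameSec e k).eval s₀ hA) =
        Linear.rightComp ℂ _ ((𝓕.pullComp (Mfd.point_comp i s₀)).inv.app E) ∘
          fun k => ((ζ₁ k).res hWW₁).eval (Mfd.toMap i s₀) hs₀W := by
      funext k
      simp [hζ k s₀ hs₀W hA, Sec.evalPull]
    exact LinearIndependent.of_comp _ (h0 ▸ linearIndependent_frameSec e s₀ hA)
  obtain ⟨N, hNW, hs₀N, a, ha⟩ := h𝓕.exists_hom_of_linearIndependent hs₀W _ hind θ
  refine ⟨N, hs₀N, a, fun s hs => ?_⟩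
  have hsA : s ∈ A := hOA' s (hW₁O (hWW₁ (hNW hs)))
  rw [← cancel_epi ((𝓕.pullComp (Mfd.point_comp i s)).hom.app E)]
  refine hom_ext_frameSec e s hsA fun k => ?_
  have h1 := ha _ hs k
  rw [hζ k s (hNW hs) hsA, hθ k s (hNW hs) hsA] at h1
  simp only [Sec.evalPull, Category.assoc, Sec.eval_map] at h1
  rw [h1]
  simp [pullHom]

end SmoothTensorStack

theorem lemmaN (𝓕 : SmoothTensorStack.{u, v, w}) (h𝓕 : 𝓕.IsEuclidean)
    (X S : Mfd.{u}) [ParacompactSpace X] (i : S ⟶ X) (hi : Mfd.IsClosedSubmanifold i)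
    (E F : 𝓕.obj X) (hE : SmoothTensorStack.IsLocallyFree ((𝓕.pull i).obj E))
    (a' : (𝓕.pull i).obj E ⟶ (𝓕.pull i).obj F) :
    ∃ a : E ⟶ F, (𝓕.pull i).map a = a' := by
  refine h𝓕.exists_extension_of_locally i a' fun x => ?_
  by_cases hx : x ∈ Set.range (Mfd.toMap i)
  · obtain ⟨s₀, rfl⟩ := hx
    exact h𝓕.exists_local_extension hi hE a' s₀
  -- Here closedness of `S` enters: its complement is an open neighbourhood on which the condition
  -- is vacuous.
  · exact ⟨⟨_, hi.2.isOpen_compl⟩, hx, 0, fun s hs => absurd ⟨s, rfl⟩ hs⟩
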